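/- Model. For $n=2^J$, $J\to\infty$, let $X_t=\alpha(t/n)+\varepsilon_t$ ($t=1,\dots,n$) be independent, nonnegative, with $\mathbb E X_t=\alpha(t/n)$ and $\operatorname{Var}X_t=h(\alpha(t/n))$ (the law may depend on $n$). For $\epsilon\in(0,1/3]$ put $\mathcal I_n=\{(j,k)\in\mathbb Z^2: 1\le k\le 2^j,\ 0\le j\le J^*-1\}$, $2^{J^*}=n^{1-\epsilon}$. For a half-width $M=M_n\in\mathbb N$, a bandwidth $b=b_n>0$ and a kernel $K$ let $$\hat\alpha_t=\frac1{2M+1}\sum_{p=t-M}^{t+M}X_p,\qquad \hat h(u)=\frac{\sum_{t=1}^n K\big((\hat\alpha_t-u)/b\big)(X_t-\hat\alpha_t)^2}{\sum_{t=1}^n K\big((\hat\alpha_t-u)/b\big)},$$ where $X_p$ with $p\notin\{1,\dots,n\}$ is given by any fixed boundary rule that replaces $p$ by an index in $\{1,\dots,n\}$ (periodic extension, reflection, …). Write $W_{nt}(u)=(nb)^{-1}K((\alpha(t/n)-u)/b)$, and let $\kappa_{j,k-q}$ be the weight of $X_q$ in the local mean at $(j,k)\in\mathcal I_n$. Assumptions.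 (1) $\alpha:[0,1]\to\mathbb R$ has finite total variation and $0<\underline\alpha=\inf\alpha\le\overline\alpha=\sup\alpha<\infty$. (2) $h:[0,\infty)\to[0,\infty)$ is non-decreasing; on $[\underline\alpha,\overline\alpha]$ it is bounded, bounded away from $0$, and Lipschitz; and some power $h^{s}$, $s>0$, is Hölder continuous on $[0,\infty)$ with some exponent $r>0$. (3) There are $K_0>0$, $\gamma\ge0$ with $\mathbb E|\varepsilon_t|^l\le (l!)^{1+\gamma}K_0^{l-2}h(\alpha(t/n))$ for all $l\ge3$, all $t$ and $n$. (5) $\kappa_{j,k-q}\ge0$, $\sum_q\kappa_{j,k-q}=1$, $\sum_q\kappa_{j,k-q}^2=O(2^{j-J})$ and $\max_q\kappa_{j,k-q}=O(2^{j-J})$, uniformly over $(j,k)\in\mathcal I_n$. (6) $K:\mathbb R\to[0,\infty)$ vanishes outside $[-1/2,1/2]$, is bounded, integrates to one and is Lipschitz. (7) $\operatorname{Var}(\varepsilon_t^2)\ge\underline c>0$ uniformly over $t$ and $n$. (8) There is $C_2>0$ with $\operatorname{Var}(\hat\alpha_t)\le C_2\operatorname{Var}|\hat\alpha_t-\mathbb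 E\hat\alpha_t|$, uniformly over $t$ and all large $n$. (9) There are $a,d>0$ with $P(\sup_{t\le n}|\varepsilon_t|\le a\log^d n)=1-O(n^{-2})$. (10) There is $c_1>0$ with $\sum_{t=1}^nW_{nt}(u)\ge c_1$ for all $u\in\operatorname{range}(\alpha)$ and all large $n$. (11) $\sum_q\kappa_{j,k-q}\alpha(q/n)\in\operatorname{range}(\alpha)$ for all $(j,k)\in\mathcal I_n$. Corollary 1. Suppose that these assumptions hold. Let $M$ be of exact order $n^{\vartheta}$ and $b$ of exact order $n^{-\zeta}$, where $(\epsilon,\vartheta,\zeta)$ lies in $$A=\{(\epsilon,\vartheta,\zeta):\epsilon\in(0,1/3],\ \zeta\in(0,\min(\vartheta/4,\ 1/2-\vartheta/2,\ \epsilon/4))\},$$ and let $\delta=\delta_n\ge c\log^{v}n$ for all large $n$, for some $c>0$ and $v<0$. Then there exists $\varsigma>0$ such that, uniformly over $(j,k)\in\mathcal I_n$, $$P\Big(\Big|\hat h\Big(\sum_q\kappa_{j,k-q}X_q\Big)-h\Big(\sum_q\kappa_{j,k-q}\,\alpha(q/n)\Big)\Big|\ge\delta\Big)= O\Big\{n^{\vartheta}\exp\Big(-\frac{n^{2\varsigma}}2\Big)+n^{-2}\Big\}.$$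 -/

import Mathlib

open MeasureTheory ProbabilityTheory Filter Asymptotics
open scoped NNReal

namespace WaveletFisz

noncomputable section

universe u

/-! ## The estimator (deterministic part, for one data vector `x 1, …, x n`) -/

/-- A boundary rule for a sample `1, …, n`: every integer `p` is replaced by an index
`pad p ∈ {1, …, n}`, and nothing is changed inside the sample. Periodic extension, reflection
and repetition of the end values are examples. -/
def IsBoundaryRule (n : ℕ) (pad : ℤ → ℕ) : Prop :=
  (∀ p : ℤ, 1 ≤ pad p ∧ pad p ≤ n) ∧ ∀ t : ℕ, 1 ≤ t → t ≤ n → pad (t : ℤ) = t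

/-- The preliminary estimator `α̂_t = (2M+1)⁻¹ ∑_{p=t-M}^{t+M} x_p`; the values `x_p` with `p`
outside the sample are read off by the boundary rule. -/
def prelim (M : ℕ) (pad : ℤ → ℕ) (x : ℕ → ℝ) (t : ℕ) : ℝ :=
  (∑ p ∈ Finset.Icc ((t : ℤ) - M) ((t : ℤ) + M), x (pad p)) / (2 * (M : ℝ) + 1)

/-- The kernel weight `(n b)⁻¹ K((a - u) / b)`. With `a = α(t/n)` this is `W_{nt}(u)`, with
`a = α̂_t` it is `Ŵ_{nt}(u)`. -/
def kernelWeight (K : ℝ → ℝ) (n : ℕ) (b a u : ℝ) : ℝ :=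
  1 / ((n : ℝ) * b) * K ((a - u) / b)

/-- The Nadaraya–Watson estimator `ĥ(u)` of the variance function, which smooths the squared
empirical residuals `(x_t - α̂_t)²`. -/
def hHat (K : ℝ → ℝ) (n M : ℕ) (b : ℝ) (pad : ℤ → ℕ) (x : ℕ → ℝ) (u : ℝ) : ℝ :=
  (∑ t ∈ Finset.Icc 1 n,
      kernelWeight K n b (prelim M pad x t) u * (x t - prelim M pad x t) ^ 2) /
    ∑ t ∈ Finset.Icc 1 n, kernelWeight K n b (prelim M pad x t) u

/-- The local mean `∑_{q=1}^n w_q x_q`. -/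
def localMean (n : ℕ) (w x : ℕ → ℝ) : ℝ :=
  ∑ q ∈ Finset.Icc 1 n, w q * x q

/-- The signal on the grid, `q ↦ α(q / n)`. -/
def gridValues (α : ℝ → ℝ) (n : ℕ) (q : ℕ) : ℝ := α ((q : ℝ) / n)

/-- The index set `𝓘_n` for `n = 2 ^ J`: pairs `(j, k)` with `1 ≤ k ≤ 2 ^ j` and
`0 ≤ j ≤ J* - 1`, where `2 ^ J* = n ^ (1 - ε)`, that is `J* = (1 - ε) J`. -/
def indexSet (ε : ℝ) (J : ℕ) : Set (ℕ × ℕ) :=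
  {p | 1 ≤ p.2 ∧ p.2 ≤ 2 ^ p.1 ∧ (p.1 : ℝ) ≤ (1 - ε) * J - 1}

/-- The set `A` of admissible triples `(ε, ϑ, ζ)`. -/
def admissible : Set (ℝ × ℝ × ℝ) :=
  {p | p.1 ∈ Set.Ioc 0 (1 / 3) ∧
    p.2.2 ∈ Set.Ioo 0 (min (p.2.1 / 4) (min (1 / 2 - p.2.1 / 2) (p.1 / 4)))}

/-! ## The signal and the variance function -/

/-- The range of `α : [0, 1] → ℝ`. -/
def signalRange (α : ℝ → ℝ) : Set ℝ := α '' Set.Icc 0 1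

/-- `inf α` and `sup α` over `[0, 1]` span this interval. -/
def signalHull (α : ℝ → ℝ) : Set ℝ := Set.Icc (sInf (signalRange α)) (sSup (signalRange α))

/-- `α` has finite total variation on `[0, 1]` and `0 < inf α ≤ sup α < ∞`. -/
structure SignalAssumption (α : ℝ → ℝ) : Prop where
  boundedVariation : BoundedVariationOn α (Set.Icc 0 1)
  bddBelow : BddBelow (signalRange α)
  inf_pos : 0 < sInf (signalRange α)
  bddAbove : BddAbove (signalRange α)

/-- The assumption on the variance function `h : [0, ∞) → [0, ∞)`. -/
structure VarianceFunctionAssumption (α h : ℝ → ℝ) : Prop where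
  nonneg : ∀ u, 0 ≤ u → 0 ≤ h u
  inf_pos : 0 < sInf (h '' signalHull α)
  bddAbove : BddAbove (h '' signalHull α)
  monotone : MonotoneOn h (Set.Ici 0)
  lipschitz : ∃ H : ℝ≥0, LipschitzOnWith H h (signalHull α)
  power_holder : ∃ (s : ℝ) (r H : ℝ≥0), 0 < s ∧ 0 < r ∧ 0 < H ∧
    HolderOnWith H r (fun u => h u ^ s) (Set.Ici 0)

/-! ## The regression model; stage `J` has sample size `n = 2 ^ J` -/

section Model

variable {Ω : ℕ → Type u} [∀ J, MeasurableSpace (Ω J)]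

/-- The noise `ε_t = X_t - α(t/n)`, `n = 2 ^ J`. -/
def noise (α : ℝ → ℝ) (X : ∀ J, ℕ → Ω J → ℝ) (J t : ℕ) (ω : Ω J) : ℝ :=
  X J t ω - gridValues α (2 ^ J) t

/-- For each `J`, the observations `X_1, …, X_n` are independent, nonnegative, with mean
`α(t/n)` and (finite) variance `h(α(t/n))`. -/
structure IsRegressionModel (P : ∀ J, Measure (Ω J)) (X : ∀ J, ℕ → Ω J → ℝ)
    (α h : ℝ → ℝ) : Prop where
  measurable : ∀ J, ∀ t ∈ Finset.Icc 1 (2 ^ J), Measurable (X J t)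
  nonneg : ∀ J, ∀ t ∈ Finset.Icc 1 (2 ^ J), ∀ᵐ ω ∂(P J), 0 ≤ X J t ω
  indep : ∀ J, iIndepFun (fun t : Finset.Icc 1 (2 ^ J) => X J t) (P J)
  memLp : ∀ J, ∀ t ∈ Finset.Icc 1 (2 ^ J), MemLp (X J t) 2 (P J)
  mean : ∀ J, ∀ t ∈ Finset.Icc 1 (2 ^ J), ∫ ω, X J t ω ∂(P J) = gridValues α (2 ^ J) t
  variance : ∀ J, ∀ t ∈ Finset.Icc 1 (2 ^ J),
    variance (X J t) (P J) = h (gridValues α (2 ^ J) t)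

/-- `E|ε_t|^l ≤ (l!)^{1+γ} K₀^{l-2} h(α(t/n))` for `l = 3, 4, …` and all `t`. -/
def MomentAssumption (P : ∀ J, Measure (Ω J)) (X : ∀ J, ℕ → Ω J → ℝ) (α h : ℝ → ℝ) : Prop :=
  ∃ K₀ γ : ℝ, 0 < K₀ ∧ 0 ≤ γ ∧ ∀ J, ∀ t ∈ Finset.Icc 1 (2 ^ J), ∀ l : ℕ, 3 ≤ l →
    Integrable (fun ω => |noise α X J t ω| ^ l) (P J) ∧
    ∫ ω, |noise α X J t ω| ^ l ∂(P J) ≤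
      (l.factorial : ℝ) ^ (1 + γ) * K₀ ^ (l - 2) * h (gridValues α (2 ^ J) t)

/-- `Var(ε_t²) ≥ c > 0`, uniformly over `t` and `n`. -/
def SquaredNoiseAssumption (P : ∀ J, Measure (Ω J)) (X : ∀ J, ℕ → Ω J → ℝ)
    (α : ℝ → ℝ) : Prop :=
  ∃ c : ℝ, 0 < c ∧ ∀ J, ∀ t ∈ Finset.Icc 1 (2 ^ J),
    c ≤ variance (fun ω => noise α X J t ω ^ 2) (P J)

/-- `Var(α̂_t) ≤ C₂ Var|α̂_t - E α̂_t|`, uniformly over `t` and (large) `n`. -/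
def AbsoluteDeviationAssumption (P : ∀ J, Measure (Ω J)) (X : ∀ J, ℕ → Ω J → ℝ)
    (M : ℕ → ℕ) (pad : ℕ → ℤ → ℕ) : Prop :=
  ∃ C₂ : ℝ, 0 < C₂ ∧ ∀ᶠ J in atTop, ∀ t ∈ Finset.Icc 1 (2 ^ J),
    variance (fun ω => prelim (M J) (pad J) (fun s => X J s ω) t) (P J) ≤
      C₂ * variance (fun ω => |prelim (M J) (pad J) (fun s => X J s ω) t -
        ∫ ω', prelim (M J) (pad J) (fun s => X J s ω') t ∂(P J)|) (P J)

/-- `P(sup_t |ε_t| ≤ a log^d n) = 1 - O(n⁻²)` for some `a, d > 0`. -/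
def TailAssumption (P : ∀ J, Measure (Ω J)) (X : ∀ J, ℕ → Ω J → ℝ) (α : ℝ → ℝ) : Prop :=
  ∃ a d : ℝ, 0 < a ∧ 0 < d ∧
    (fun J : ℕ => 1 - (P J).real {ω | ∀ t ∈ Finset.Icc 1 (2 ^ J),
      |noise α X J t ω| ≤ a * Real.log ((2 : ℝ) ^ J) ^ d})
    =O[atTop] fun J : ℕ => (((2 : ℝ) ^ J) ^ 2)⁻¹

end Model

/-! ## Kernel, bandwidth and local weights -/

/-- The kernel `K` lives on `[-1/2, 1/2]`, is zero elsewhere, nonnegative, bounded, integrates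
to one and is Lipschitz continuous. -/
structure KernelAssumption (K : ℝ → ℝ) : Prop where
  support : ∀ z, z ∉ Set.Icc (-(1 / 2) : ℝ) (1 / 2) → K z = 0
  nonneg : ∀ z, 0 ≤ K z
  bounded : BddAbove (Set.range K)
  integral_one : ∫ z in (-(1 / 2) : ℝ)..(1 / 2), K z = 1
  lipschitz : ∃ L : ℝ≥0, LipschitzWith L K

/-- `∑_t W_{nt}(u) ≥ c₁ > 0`, uniformly over `u` in the range of `α` and over large `n`, with
the bandwidth `b` belonging to `n`. -/
def DesignAssumption (α K : ℝ → ℝ) (b : ℕ → ℝ) : Prop :=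
  ∃ c₁ : ℝ, 0 < c₁ ∧ ∀ᶠ J in atTop, ∀ u ∈ signalRange α,
    c₁ ≤ ∑ t ∈ Finset.Icc 1 (2 ^ J), kernelWeight K (2 ^ J) (b J) (gridValues α (2 ^ J) t) u

/-- The weights `κ J j k q` (the weight `κ_{j,k-q}` of `X_q` in the local mean at `(j, k)` when
`n = 2 ^ J`) are nonnegative, sum to one, and `∑_q κ² = O(2^{j-J})`, `max_q κ = O(2^{j-J})`,
uniformly over `𝓘_n`. -/
structure WeightAssumption (ε : ℝ) (κ : ℕ → ℕ → ℕ → ℕ → ℝ) : Prop where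
  nonneg : ∀ J, ∀ p ∈ indexSet ε J, ∀ q ∈ Finset.Icc 1 (2 ^ J), 0 ≤ κ J p.1 p.2 q
  sum_one : ∀ J, ∀ p ∈ indexSet ε J, ∑ q ∈ Finset.Icc 1 (2 ^ J), κ J p.1 p.2 q = 1
  sum_sq : ∃ C : ℝ, ∀ J, ∀ p ∈ indexSet ε J,
    ∑ q ∈ Finset.Icc 1 (2 ^ J), κ J p.1 p.2 q ^ 2 ≤ C * ((2 : ℝ) ^ p.1 / 2 ^ J)
  max_le : ∃ C : ℝ, ∀ J, ∀ p ∈ indexSet ε J, ∀ q ∈ Finset.Icc 1 (2 ^ J),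
    κ J p.1 p.2 q ≤ C * ((2 : ℝ) ^ p.1 / 2 ^ J)

/-- The local means of `α` lie in the range of `α`. -/
def LocalMeanAssumption (α : ℝ → ℝ) (ε : ℝ) (κ : ℕ → ℕ → ℕ → ℕ → ℝ) : Prop :=
  ∀ J, ∀ p ∈ indexSet ε J,
    localMean (2 ^ J) (κ J p.1 p.2) (gridValues α (2 ^ J)) ∈ signalRange α

end

end WaveletFisz

/-
On the event that every noise variable is at most `a log^d n`, which has probability `1 - O(n⁻²)`,
the noise may be truncated there, and Hoeffding's inequality with exponent `3 log n` bounds at once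
the local mean of the noise, all its moving averages, and the kernel-smoothed centred squares. The
bias of the moving averages need not be small at a single point, but it telescopes when summed over
the sample: a signal of bounded variation has increments dominated by those of a monotone function,
so the average bias is `O(M / n)`. As the kernel is Lipschitz, replacing the random centres `α̂_t`
by `α(t/n)` and the evaluation point by its mean costs a negative power of the bandwidth times these
errors. Where the kernel does not vanish, `h(α(t/n))` is within `O(b)` of `h(u)`. Under the
conditions on the exponents all of this is polynomially small in `n`, hence below `c log^v n`.
-/

namespace WaveletFisz

lemma abs_sum_mul_le_sum_abs_mul {ι : Type*} {s : Finset ι} {w e : ι → ℝ} {τ : ℝ}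
    (h : ∀ i ∈ s, |e i| ≤ τ) : |∑ i ∈ s, w i * e i| ≤ (∑ i ∈ s, |w i|) * τ := by
  rw [Finset.sum_mul]
  refine (Finset.abs_sum_le_sum_abs _ _).trans (Finset.sum_le_sum fun i hi => ?_)
  rw [abs_mul]
  exact mul_le_mul_of_nonneg_left (h i hi) (abs_nonneg _)

section Concentration

variable {Ω : Type*} [MeasurableSpace Ω] {μ : Measure Ω}

lemma abs_integral_sub_integral_indicator_le [IsFiniteMeasure μ] {Z : Ω → ℝ} {A : Set Ω}
    (hZ : MemLp Z 2 μ) (hA : MeasurableSet A) :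
    |∫ ω, Z ω ∂μ - ∫ ω, A.indicator Z ω ∂μ| ≤ √((∫ ω, Z ω ^ 2 ∂μ) * μ.real Aᶜ) := by
  have hZ_int : Integrable Z μ := hZ.integrable one_le_two
  have hone : MemLp (Aᶜ.indicator fun _ => (1 : ℝ)) 2 μ := (memLp_const 1).indicator hA.compl
  have hsplit : ∀ ω, |Z ω - A.indicator Z ω| = |Z ω| * |Aᶜ.indicator (fun _ => (1 : ℝ)) ω| := by
    intro ω
    by_cases hω : ω ∈ A <;> simp [hω]
  have hsq : ∀ ω, Aᶜ.indicator (fun _ => (1 : ℝ)) ω ^ 2 = Aᶜ.indicator 1 ω := by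
    intro ω
    by_cases hω : ω ∈ A <;> simp [hω]
  have hCauchySchwarz := integral_mul_norm_le_Lp_mul_Lq (μ := μ) Real.HolderConjugate.two_two
    (by simpa using hZ) (by simpa using hone)
  simp only [Real.norm_eq_abs, Real.rpow_two, sq_abs, ← Real.sqrt_eq_rpow] at hCauchySchwarz
  simp only [hsq, ← hsplit, integral_indicator_one hA.compl] at hCauchySchwarz
  rw [← integral_sub hZ_int (hZ_int.indicator hA), Real.sqrt_mul' _ measureReal_nonneg]
  exact abs_integral_le_integral_abs.trans hCauchySchwarz

variable {ι : Type*} [Fintype ι] [IsProbabilityMeasure μ] {Y : ι → Ω → ℝ} {w : ι → ℝ}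

lemma hasSubgaussianMGF_sum_mul_sub_integral {B : ℝ} (hY : ∀ i, AEMeasurable (Y i) μ)
    (hind : iIndepFun Y μ) (hB : ∀ i, ∀ᵐ ω ∂μ, |Y i ω| ≤ B) :
    HasSubgaussianMGF (fun ω => ∑ i, w i * (Y i ω - ∫ ω', Y i ω' ∂μ))
      (∑ i, ‖w i * B‖₊ ^ 2) μ := by
  refine HasSubgaussianMGF.sum_of_iIndepFun
    (hind.comp (fun i x => w i * (x - ∫ ω', Y i ω' ∂μ)) fun i => by fun_prop) fun i _ => ?_
  have hbound : ∀ᵐ ω ∂μ, w i * Y i ω ∈ Set.Icc (-|w i * B|) |w i * B| := by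
    filter_upwards [hB i] with ω hω
    rw [Set.mem_Icc, ← abs_le, abs_mul, abs_mul]
    exact mul_le_mul_of_nonneg_left (hω.trans (le_abs_self B)) (abs_nonneg _)
  have hsub := hasSubgaussianMGF_of_mem_Icc ((hY i).const_mul (w i)) hbound
  have hparam : (‖|w i * B| - -|w i * B|‖₊ / 2) ^ 2 = ‖w i * B‖₊ ^ 2 := by
    rw [sub_neg_eq_add, ← two_mul, nnnorm_mul, Real.nnnorm_abs, Real.nnnorm_two,
      mul_div_cancel_left₀ _ two_ne_zero]
  rw [hparam, integral_const_mul] at hsub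
  simpa only [mul_sub, Function.comp_def] using hsub

lemma hoeffding_weighted {B r : ℝ} (hY : ∀ i, AEMeasurable (Y i) μ) (hind : iIndepFun Y μ)
    (hB : ∀ i, ∀ᵐ ω ∂μ, |Y i ω| ≤ B) (hB_pos : 0 < B) (hw : 0 < ∑ i, w i ^ 2) (hr : 0 ≤ r) :
    μ.real {ω | B * √(2 * r * ∑ i, w i ^ 2) ≤ |∑ i, w i * (Y i ω - ∫ ω', Y i ω' ∂μ)|} ≤
      2 * Real.exp (-r) := by
  set V : ℝ := ∑ i, w i ^ 2
  set s : ℝ := B * √(2 * r * V)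
  have hs : 0 ≤ s := by positivity
  have hparam : ((∑ i, ‖w i * B‖₊ ^ 2 : ℝ≥0) : ℝ) = B ^ 2 * V := by
    push_cast
    simp only [Real.norm_eq_abs, sq_abs, mul_pow, ← Finset.sum_mul]
    exact mul_comm _ _
  have hexp : -s ^ 2 / (2 * ((∑ i, ‖w i * B‖₊ ^ 2 : ℝ≥0) : ℝ)) = -r := by
    rw [hparam, mul_pow, Real.sq_sqrt (by positivity)]
    field_simp
  have hsub := hasSubgaussianMGF_sum_mul_sub_integral (w := w) hY hind hB
  have hupper := hsub.measure_ge_le hs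
  have hlower := hsub.neg.measure_ge_le hs
  rw [hexp] at hupper hlower
  rw [two_mul]
  refine (measureReal_mono fun ω hω => ?_).trans
    ((measureReal_union_le _ _).trans (add_le_add hupper hlower))
  exact le_abs.1 hω.out

lemma measureReal_lt_abs_sum_mul_sub_integral_le {B r m q : ℝ} (hY : ∀ i, Measurable (Y i))
    (hind : iIndepFun Y μ) (hL2 : ∀ i, MemLp (Y i) 2 μ) (hm : ∀ i, ∫ ω, Y i ω ^ 2 ∂μ ≤ m)
    (hq : ∀ i, μ.real {ω | |Y i ω| ≤ B}ᶜ ≤ q) (hB : 0 < B) (hw : 0 < ∑ i, w i ^ 2)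
    (hr : 0 ≤ r) :
    μ.real {ω | (∀ i, |Y i ω| ≤ B) ∧ B * √(2 * r * ∑ i, w i ^ 2) + (∑ i, |w i|) * √(m * q) <
        |∑ i, w i * (Y i ω - ∫ ω', Y i ω' ∂μ)|} ≤ 2 * Real.exp (-r) := by
  set T : Set ℝ := {y | |y| ≤ B}
  have hT : MeasurableSet T := measurableSet_le (by fun_prop) measurable_const
  have hcut : Measurable (T.indicator fun y : ℝ => y) := measurable_id.indicator hT
  set Z : ι → Ω → ℝ := fun i ω => T.indicator (fun y : ℝ => y) (Y i ω)
  have hZ_bound : ∀ i ω, |Z i ω| ≤ B := by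
    intro i ω
    by_cases h : Y i ω ∈ T
    · simpa only [Z, Set.indicator_of_mem h] using h.out
    · simpa only [Z, Set.indicator_of_notMem h, abs_zero] using hB.le
  have hbias : ∀ i, |∫ ω, Y i ω ∂μ - ∫ ω, Z i ω ∂μ| ≤ √(m * q) := by
    intro i
    refine (abs_integral_sub_integral_indicator_le (hL2 i) (hY i hT)).trans
      (Real.sqrt_le_sqrt (mul_le_mul (hm i) (hq i) measureReal_nonneg ?_))
    exact (integral_nonneg fun ω => sq_nonneg (Y i ω)).trans (hm i)
  refine (measureReal_mono ?_).trans (hoeffding_weighted (w := w)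
    (fun i => (hcut.comp (hY i)).aemeasurable) (hind.comp _ fun _ => hcut)
    (fun i => .of_forall (hZ_bound i)) hB hw hr)
  rintro ω ⟨hω, hlt⟩
  have hrecenter : ∑ i, w i * (Y i ω - ∫ ω', Y i ω' ∂μ) =
      ∑ i, w i * (Z i ω - ∫ ω', Z i ω' ∂μ) -
        ∑ i, w i * (∫ ω', Y i ω' ∂μ - ∫ ω', Z i ω' ∂μ) := by
    rw [← Finset.sum_sub_distrib]
    refine Finset.sum_congr rfl fun i _ => ?_
    rw [show Z i ω = Y i ω from Set.indicator_of_mem (s := T) (hω i) _]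
    ring
  have hdrift := abs_sum_mul_le_sum_abs_mul (s := Finset.univ) (w := w) fun i _ => hbias i
  rw [hrecenter] at hlt
  have htri := hlt.trans_le (abs_sub _ _)
  exact Set.mem_ofPred.2 (by simp only [Function.comp_apply]; linarith)

end Concentration

section BoundedVariation

lemma exists_monotone_dominating {β E : Type*} [LinearOrder β] [PseudoMetricSpace E] {f : β → E}
    {s : Set β} {V : ℝ≥0} (hf : eVariationOn f s ≤ V) :
    ∃ g : β → ℝ, Monotone g ∧ (∀ x y, g y - g x ≤ V) ∧
      ∀ x ∈ s, ∀ y ∈ s, x ≤ y → dist (f x) (f y) ≤ g y - g x := by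
  have hV : ∀ t, eVariationOn f (s ∩ Set.Iic t) ≤ V := fun t =>
    (eVariationOn.mono f Set.inter_subset_left).trans hf
  have hfin : ∀ t, eVariationOn f (s ∩ Set.Iic t) ≠ ⊤ := fun t =>
    ne_top_of_le_ne_top ENNReal.coe_ne_top (hV t)
  refine ⟨fun t => (eVariationOn f (s ∩ Set.Iic t)).toReal, fun x y hxy => ?_, fun x y => ?_,
    fun x hx y hy hxy => ?_⟩
  · refine ENNReal.toReal_mono (hfin y) (eVariationOn.mono f ?_)
    exact Set.inter_subset_inter_right s (Set.Iic_subset_Iic.2 hxy)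
  · exact (sub_le_self _ ENNReal.toReal_nonneg).trans
      (ENNReal.toReal_mono ENNReal.coe_ne_top (hV y))
  · have hadd : eVariationOn f (s ∩ Set.Iic x) + edist (f x) (f y) ≤
        eVariationOn f (s ∩ Set.Iic y) := by
      calc eVariationOn f (s ∩ Set.Iic x) + edist (f x) (f y)
          ≤ eVariationOn f (s ∩ Set.Iic x) + eVariationOn f (s ∩ Set.Icc x y) := by
            gcongr
            exact eVariationOn.edist_le f ⟨hx, le_rfl, hxy⟩ ⟨hy, hxy, le_rfl⟩
        _ ≤ eVariationOn f (s ∩ Set.Iic x ∪ s ∩ Set.Icc x y) :=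
            eVariationOn.add_le_union f fun u hu v hv => hu.2.out.trans hv.2.1
        _ ≤ eVariationOn f (s ∩ Set.Iic y) := by
            refine eVariationOn.mono f (Set.union_subset ?_ ?_)
            · exact Set.inter_subset_inter_right s (Set.Iic_subset_Iic.2 hxy)
            · exact Set.inter_subset_inter_right s Set.Icc_subset_Iic_self
    have hreal := ENNReal.toReal_mono (hfin y) hadd
    rw [ENNReal.toReal_add (hfin x) (edist_ne_top _ _), edist_dist,
      ENNReal.toReal_ofReal dist_nonneg] at hreal
    exact le_sub_iff_add_le'.2 hreal

lemma div_mem_Icc_zero_one {n t : ℕ} (ht : t ∈ Set.Icc 1 n) : (t / n : ℝ) ∈ Set.Icc (0 : ℝ) 1 :=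
  ⟨by positivity, div_le_one_of_le₀ (Nat.cast_le.2 ht.2) (Nat.cast_nonneg n)⟩

lemma gridValues_mem_signalRange (α : ℝ → ℝ) {n t : ℕ} (ht : t ∈ Set.Icc 1 n) :
    gridValues α n t ∈ signalRange α :=
  Set.mem_image_of_mem α (div_mem_Icc_zero_one ht)

lemma eVariationOn_gridValues_le (α : ℝ → ℝ) (n : ℕ) :
    eVariationOn (gridValues α n) (Set.Icc 1 n) ≤ eVariationOn α (Set.Icc 0 1) :=
  eVariationOn.comp_le_of_monotoneOn α (fun t : ℕ => (t : ℝ) / n)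
    (fun _ _ _ _ hst => div_le_div_of_nonneg_right (Nat.cast_le.2 hst) (Nat.cast_nonneg n))
    fun _ ht => div_mem_Icc_zero_one ht

end BoundedVariation

section MovingAverage

/-- The centres `t` of the moving averages of half-width `M` that do not use the boundary rule. -/
def interior (n M : ℕ) : Finset ℕ := Finset.Icc (M + 1) (n - M)

/-- The weights of the moving average of half-width `M` around `t`, which turn `prelim` into a
`localMean` when `t ∈ interior n M`. -/
noncomputable def windowWeight (M t q : ℕ) : ℝ :=
  if q ∈ Finset.Icc (t - M) (t + M) then 1 / (2 * (M : ℝ) + 1) else 0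

variable {n M t : ℕ} {pad : ℤ → ℕ} {x a : ℕ → ℝ}

lemma interior_subset (n M : ℕ) : interior n M ⊆ Finset.Icc 1 n :=
  Finset.Icc_subset_Icc (Nat.le_add_left 1 M) (Nat.sub_le n M)

lemma window_subset (ht : t ∈ interior n M) :
    Finset.Icc (t - M) (t + M) ⊆ Finset.Icc 1 n := by
  rw [interior, Finset.mem_Icc] at ht
  exact Finset.Icc_subset_Icc (by omega) (by omega)

lemma card_window (ht : t ∈ interior n M) : (Finset.Icc (t - M) (t + M)).card = 2 * M + 1 := by
  rw [interior, Finset.mem_Icc] at ht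
  rw [Nat.card_Icc]
  omega

lemma windowWeight_nonneg (M t q : ℕ) : 0 ≤ windowWeight M t q := by
  unfold windowWeight
  split_ifs <;> positivity

lemma sum_windowWeight_mul (ht : t ∈ interior n M) (f : ℕ → ℝ) :
    ∑ q ∈ Finset.Icc 1 n, windowWeight M t q * f q =
      (∑ q ∈ Finset.Icc (t - M) (t + M), f q) / (2 * M + 1) := by
  simp only [windowWeight, ite_mul, zero_mul]
  rw [Finset.sum_ite_mem, Finset.inter_eq_right.2 (window_subset ht), ← Finset.mul_sum,
    one_div_mul_eq_div]

lemma sum_windowWeight (ht : t ∈ interior n M) :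
    ∑ q ∈ Finset.Icc 1 n, windowWeight M t q = 1 := by
  have h := sum_windowWeight_mul ht fun _ => 1
  simp only [mul_one, Finset.sum_const, card_window ht, nsmul_eq_mul] at h
  push_cast at h
  rw [h, div_self (by positivity)]

lemma sum_windowWeight_sq (ht : t ∈ interior n M) :
    ∑ q ∈ Finset.Icc 1 n, windowWeight M t q ^ 2 = 1 / (2 * M + 1) := by
  have hsq : ∀ q, windowWeight M t q ^ 2 = windowWeight M t q * (1 / (2 * M + 1)) := by
    intro q
    unfold windowWeight
    split_ifs <;> ring
  simp only [hsq, ← Finset.sum_mul, sum_windowWeight ht, one_mul]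

lemma sum_int_window (hpad : IsBoundaryRule n pad) (ht : t ∈ interior n M) (f : ℕ → ℝ) :
    ∑ p ∈ Finset.Icc ((t : ℤ) - M) (t + M), f (pad p) =
      ∑ q ∈ Finset.Icc (t - M) (t + M), f q := by
  rw [interior, Finset.mem_Icc] at ht
  refine Finset.sum_bij' (fun p _ => p.toNat) (fun q _ => (q : ℤ)) ?_ ?_ ?_ ?_ ?_ <;>
    intro p hp <;> rw [Finset.mem_Icc] at hp
  · rw [Finset.mem_Icc]; omega
  · rw [Finset.mem_Icc]; omega
  · omega
  · omega
  · lift p to ℕ using (by omega)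
    rw [hpad.2 p (by omega) (by omega), Int.toNat_natCast]

lemma prelim_eq_localMean (hpad : IsBoundaryRule n pad) (ht : t ∈ interior n M) (x : ℕ → ℝ) :
    prelim M pad x t = localMean n (windowWeight M t) x := by
  rw [prelim, localMean, sum_windowWeight_mul ht, sum_int_window hpad ht]

lemma abs_prelim_sub_le {c R : ℝ}
    (h : ∀ p ∈ Finset.Icc ((t : ℤ) - M) (t + M), |x (pad p) - c| ≤ R) :
    |prelim M pad x t - c| ≤ R := by
  have hcard : ((Finset.Icc ((t : ℤ) - M) (t + M)).card : ℝ) = 2 * M + 1 := by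
    have : (Finset.Icc ((t : ℤ) - M) (t + M)).card = 2 * M + 1 := by
      rw [Int.card_Icc]; omega
    exact_mod_cast this
  have hpos : (0 : ℝ) < 2 * M + 1 := by positivity
  have hsub : prelim M pad x t - c =
      (∑ p ∈ Finset.Icc ((t : ℤ) - M) (t + M), (x (pad p) - c)) / (2 * M + 1) := by
    rw [Finset.sum_sub_distrib, Finset.sum_const, nsmul_eq_mul, hcard, sub_div,
      mul_div_cancel_left₀ _ hpos.ne', prelim]
  rw [hsub, abs_div, abs_of_pos hpos, div_le_iff₀ hpos]
  calc |∑ p ∈ Finset.Icc ((t : ℤ) - M) (t + M), (x (pad p) - c)|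
      ≤ ∑ _p ∈ Finset.Icc ((t : ℤ) - M) (t + M), R :=
        (Finset.abs_sum_le_sum_abs _ _).trans (Finset.sum_le_sum h)
    _ = R * (2 * M + 1) := by rw [Finset.sum_const, nsmul_eq_mul, hcard, mul_comm]

lemma abs_prelim_sub_self_le_of_increment {g : ℕ → ℝ} (hpad : IsBoundaryRule n pad)
    (hg : Monotone g)
    (hag : ∀ i ∈ Set.Icc 1 n, ∀ j ∈ Set.Icc 1 n, i ≤ j → dist (a i) (a j) ≤ g j - g i)
    (ht : t ∈ interior n M) :
    |prelim M pad a t - a t| ≤ g (t + M) - g (t - M) := by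
  rw [interior, Finset.mem_Icc] at ht
  refine abs_prelim_sub_le fun p hp => ?_
  rw [Finset.mem_Icc] at hp
  lift p to ℕ using (by omega)
  rw [hpad.2 p (by omega) (by omega), ← Real.dist_eq]
  have ht' : t ∈ Set.Icc 1 n := ⟨by omega, by omega⟩
  have hp' : p ∈ Set.Icc 1 n := ⟨by omega, by omega⟩
  rcases le_total p t with hpt | htp
  · exact (hag p hp' t ht' hpt).trans (sub_le_sub (hg (by omega)) (hg (by omega)))
  · rw [dist_comm]
    exact (hag t ht' p hp' htp).trans (sub_le_sub (hg (by omega)) (hg (by omega)))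

lemma sum_shift_sub_le {g : ℕ → ℝ} {V : ℝ} (hV : ∀ i j, g j - g i ≤ V) (m k : ℕ) :
    ∑ t ∈ Finset.range m, (g (t + k) - g t) ≤ k * V := by
  induction k with
  | zero => simp
  | succ k ih =>
    have hsplit : ∑ t ∈ Finset.range m, (g (t + (k + 1)) - g t) =
        ∑ t ∈ Finset.range m, (g (t + 1 + k) - g (t + k)) +
          ∑ t ∈ Finset.range m, (g (t + k) - g t) := by
      rw [← Finset.sum_add_distrib]
      refine Finset.sum_congr rfl fun t _ => ?_
      rw [add_assoc t 1 k, add_comm 1 k, sub_add_sub_cancel]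
    rw [hsplit, Finset.sum_range_sub (fun t => g (t + k)), Nat.cast_succ, add_one_mul, add_comm]
    exact add_le_add ih (hV _ _)

lemma sum_interior_increment_le {g : ℕ → ℝ} {V : ℝ} (hV : ∀ i j, g j - g i ≤ V) (n M : ℕ) :
    ∑ t ∈ interior n M, (g (t + M) - g (t - M)) ≤ 2 * M * V := by
  have hinterior : interior n M = Finset.Ico (M + 1) (n - M + 1) := by
    ext t
    rw [interior, Finset.mem_Icc, Finset.mem_Ico, Nat.lt_succ_iff]
  have hshift := sum_shift_sub_le (g := fun i => g (i + 1)) (fun i j => hV _ _)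
    (n - M + 1 - (M + 1)) (2 * M)
  rw [Nat.cast_mul, Nat.cast_two] at hshift
  rw [hinterior, Finset.sum_Ico_eq_sum_range]
  refine (Finset.sum_congr rfl fun i _ => ?_).trans_le hshift
  congr 2 <;> omega

lemma sum_le_sum_interior_add {d : ℕ → ℝ} {R : ℝ} (hR : 0 ≤ R)
    (hd : ∀ t ∈ Finset.Icc 1 n, d t ≤ R) :
    ∑ t ∈ Finset.Icc 1 n, d t ≤ ∑ t ∈ interior n M, d t + 2 * M * R := by
  have hcard : (Finset.Icc 1 n \ interior n M).card ≤ 2 * M := by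
    rw [Finset.card_sdiff_of_subset (interior_subset n M), interior, Nat.card_Icc, Nat.card_Icc]
    omega
  rw [← Finset.sum_sdiff (interior_subset n M), add_comm]
  gcongr
  calc ∑ t ∈ Finset.Icc 1 n \ interior n M, d t
      ≤ (Finset.Icc 1 n \ interior n M).card • R :=
        Finset.sum_le_card_nsmul _ _ _ fun t ht => hd t (Finset.sdiff_subset ht)
    _ ≤ 2 * M * R := by
        rw [nsmul_eq_mul]
        exact mul_le_mul_of_nonneg_right (mod_cast hcard) hR

lemma abs_prelim_sub_le_of_eVariationOn_le {L : ℝ} {V : ℝ≥0} (hpad : IsBoundaryRule n pad)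
    (ha : eVariationOn a (Set.Icc 1 n) ≤ V) (hnoise : ∀ t ∈ Finset.Icc 1 n, |x t - a t| ≤ L)
    (ht : t ∈ Finset.Icc 1 n) :
    |prelim M pad x t - a t| ≤ L + V := by
  refine abs_prelim_sub_le fun p _ => ?_
  have hp : pad p ∈ Finset.Icc 1 n := Finset.mem_Icc.2 (hpad.1 p)
  have hvar : dist (a (pad p)) (a t) ≤ V := by
    rw [dist_nndist, NNReal.coe_le_coe, ← edist_le_coe]
    exact (eVariationOn.edist_le a (Finset.mem_Icc.1 hp) (Finset.mem_Icc.1 ht)).trans ha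
  exact (abs_sub_le _ _ _).trans (add_le_add (hnoise _ hp) hvar)

lemma sum_abs_prelim_sub_le {A L : ℝ} {V : ℝ≥0} (hpad : IsBoundaryRule n pad)
    (ha : eVariationOn a (Set.Icc 1 n) ≤ V) (hA : 0 ≤ A) (hL : 0 ≤ L)
    (hnoise : ∀ t ∈ Finset.Icc 1 n, |x t - a t| ≤ L)
    (hwindow : ∀ t ∈ interior n M, |prelim M pad x t - prelim M pad a t| ≤ A) :
    ∑ t ∈ Finset.Icc 1 n, |prelim M pad x t - a t| ≤ n * A + 2 * M * (2 * V + L) := by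
  obtain ⟨g, hg, hgV, hag⟩ := exists_monotone_dominating ha
  have hinterior : ∑ t ∈ interior n M, |prelim M pad x t - a t| ≤ n * A + 2 * M * V := by
    calc ∑ t ∈ interior n M, |prelim M pad x t - a t|
        ≤ ∑ t ∈ interior n M, (A + (g (t + M) - g (t - M))) :=
          Finset.sum_le_sum fun t ht => (abs_sub_le _ (prelim M pad a t) _).trans <|
            add_le_add (hwindow t ht) (abs_prelim_sub_self_le_of_increment hpad hg hag ht)
      _ = (interior n M).card * A + ∑ t ∈ interior n M, (g (t + M) - g (t - M)) := by
          rw [Finset.sum_add_distrib, Finset.sum_const, nsmul_eq_mul]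
      _ ≤ n * A + 2 * M * V := by
          have hcard : (interior n M).card ≤ n := by
            simpa using Finset.card_le_card (interior_subset n M)
          gcongr
          exact sum_interior_increment_le hgV n M
  have hsplit := sum_le_sum_interior_add (M := M) (d := fun t => |prelim M pad x t - a t|)
    (by positivity) fun t ht => abs_prelim_sub_le_of_eVariationOn_le hpad ha hnoise ht
  linarith

end MovingAverage

section KernelRegression

lemma sum_mul_div_sum_sub {ι : Type*} {s : Finset ι} {W W' : ι → ℝ} (hW' : ∑ i ∈ s, W' i ≠ 0)
    (y z g : ι → ℝ) (c : ℝ) :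
    (∑ i ∈ s, W' i * y i) / ∑ i ∈ s, W' i - c =
      (∑ i ∈ s, W' i * (y i - z i) + ∑ i ∈ s, (W' i - W i) * (z i - c) +
        ∑ i ∈ s, W i * (z i - g i) + ∑ i ∈ s, W i * (g i - c)) / ∑ i ∈ s, W' i := by
  rw [div_sub' hW']
  congr 1
  simp only [Finset.sum_mul, ← Finset.sum_sub_distrib, ← Finset.sum_add_distrib]
  exact Finset.sum_congr rfl fun i _ => by ring

lemma abs_sum_mul_div_sum_sub_le {ι : Type*} {s : Finset ι} {W W' y z g : ι → ℝ}
    {c c₁ E₁ E₂ T B : ℝ} (hc₁ : 0 < c₁) (hW : c₁ ≤ ∑ i ∈ s, W i)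
    (hdiff : ∑ i ∈ s, |W' i - W i| ≤ c₁ / 2)
    (hE₁ : |∑ i ∈ s, W' i * (y i - z i)| ≤ E₁)
    (hE₂ : |∑ i ∈ s, (W' i - W i) * (z i - c)| ≤ E₂)
    (hT : |∑ i ∈ s, W i * (z i - g i)| ≤ T)
    (hB : |∑ i ∈ s, W i * (g i - c)| ≤ (∑ i ∈ s, W i) * B) :
    |(∑ i ∈ s, W' i * y i) / ∑ i ∈ s, W' i - c| ≤ 2 / c₁ * (E₁ + E₂ + T) + 2 * B := by
  set D := ∑ i ∈ s, W i
  set D' := ∑ i ∈ s, W' i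
  have hD : 0 < D := hc₁.trans_le hW
  have hB_nonneg : 0 ≤ B := nonneg_of_mul_nonneg_right ((abs_nonneg _).trans hB) hD
  have hE_nonneg : 0 ≤ E₁ + E₂ + T :=
    add_nonneg (add_nonneg ((abs_nonneg _).trans hE₁) ((abs_nonneg _).trans hE₂))
      ((abs_nonneg _).trans hT)
  have hdenom : D ≤ 2 * D' := by
    have hDD' : |D' - D| ≤ c₁ / 2 := by
      rw [← Finset.sum_sub_distrib]
      exact (Finset.abs_sum_le_sum_abs _ _).trans hdiff
    linarith [(abs_le.1 hDD').1]
  have hD' : 0 < D' := by linarith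
  rw [sum_mul_div_sum_sub (W := W) hD'.ne' y z g c, abs_div, abs_of_pos hD', div_le_iff₀ hD']
  calc _ ≤ E₁ + E₂ + T + D * B :=
        (abs_add_le _ _).trans <| add_le_add ((abs_add_le _ _).trans <|
          add_le_add ((abs_add_le _ _).trans <| add_le_add hE₁ hE₂) hT) hB
    _ ≤ 2 * D' / c₁ * (E₁ + E₂ + T) + 2 * D' * B := by
        gcongr
        exact le_mul_of_one_le_left hE_nonneg ((one_le_div hc₁).2 (hW.trans hdenom))
    _ = (2 / c₁ * (E₁ + E₂ + T) + 2 * B) * D' := by ring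

variable {K : ℝ → ℝ} {n M : ℕ} {b : ℝ} {Lk : ℝ≥0}

lemma kernelWeight_nonneg (hK_nonneg : ∀ z, 0 ≤ K z) (n : ℕ) (hb : 0 < b) (a u : ℝ) :
    0 ≤ kernelWeight K n b a u :=
  mul_nonneg (by positivity) (hK_nonneg _)

lemma le_of_lipschitzWith_of_support (hK_lip : LipschitzWith Lk K)
    (hK_supp : ∀ z, z ∉ Set.Icc (-(1 / 2) : ℝ) (1 / 2) → K z = 0) (z : ℝ) : K z ≤ Lk := by
  obtain ⟨z', hz', hzz'⟩ : ∃ z', K z' = 0 ∧ dist z z' = 1 := by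
    rcases le_total z 0 with hz | hz
    · exact ⟨z - 1, hK_supp _ fun h => by linarith [h.1], by simp⟩
    · exact ⟨z + 1, hK_supp _ fun h => by linarith [h.2], by simp⟩
  have hdist := hK_lip.dist_le_mul z z'
  rw [hz', hzz', mul_one, Real.dist_eq, sub_zero] at hdist
  exact (le_abs_self _).trans hdist

lemma kernelWeight_le (hK_lip : LipschitzWith Lk K)
    (hK_supp : ∀ z, z ∉ Set.Icc (-(1 / 2) : ℝ) (1 / 2) → K z = 0) (n : ℕ) (hb : 0 < b)
    (a u : ℝ) : kernelWeight K n b a u ≤ Lk / (n * b) := by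
  rw [kernelWeight, one_div_mul_eq_div]
  gcongr
  exact le_of_lipschitzWith_of_support hK_lip hK_supp _

lemma abs_kernelWeight_sub_le (hK_lip : LipschitzWith Lk K) (n : ℕ) (hb : 0 < b)
    (a u a' u' : ℝ) :
    |kernelWeight K n b a u - kernelWeight K n b a' u'| ≤
      Lk / (n * b ^ 2) * (|a - a'| + |u - u'|) := by
  have hdist := hK_lip.dist_le_mul ((a - u) / b) ((a' - u') / b)
  rw [Real.dist_eq, Real.dist_eq, ← sub_div, sub_sub_sub_comm, abs_div, abs_of_pos hb] at hdist
  rw [kernelWeight, kernelWeight, ← mul_sub, abs_mul, abs_of_nonneg (by positivity)]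
  calc 1 / (n * b) * |K ((a - u) / b) - K ((a' - u') / b)|
      ≤ 1 / (n * b) * (Lk * ((|a - a'| + |u - u'|) / b)) := by
        gcongr
        refine hdist.trans ?_
        gcongr
        exact abs_sub _ _
    _ = Lk / (n * b ^ 2) * (|a - a'| + |u - u'|) := by ring

lemma abs_sub_le_of_kernelWeight_ne_zero
    (hK_supp : ∀ z, z ∉ Set.Icc (-(1 / 2) : ℝ) (1 / 2) → K z = 0) (hb : 0 < b) {a u : ℝ}
    (h : kernelWeight K n b a u ≠ 0) : |a - u| ≤ b := by
  have hmem : (a - u) / b ∈ Set.Icc (-(1 / 2) : ℝ) (1 / 2) := by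
    by_contra hz
    exact h (by rw [kernelWeight, hK_supp _ hz, mul_zero])
  have habs := abs_le.2 hmem
  rw [abs_div, abs_of_pos hb, div_le_iff₀ hb] at habs
  linarith

lemma abs_sum_kernelWeight_mul_sub_le {h : ℝ → ℝ} {H : ℝ≥0} {S : Set ℝ} {a : ℕ → ℝ} {u : ℝ}
    (hK_nonneg : ∀ z, 0 ≤ K z)
    (hK_supp : ∀ z, z ∉ Set.Icc (-(1 / 2) : ℝ) (1 / 2) → K z = 0) (hb : 0 < b)
    (hh : LipschitzOnWith H h S) (ha : ∀ t ∈ Finset.Icc 1 n, a t ∈ S) (hu : u ∈ S) :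
    |∑ t ∈ Finset.Icc 1 n, kernelWeight K n b (a t) u * (h (a t) - h u)| ≤
      (∑ t ∈ Finset.Icc 1 n, kernelWeight K n b (a t) u) * (H * b) := by
  rw [Finset.sum_mul]
  refine (Finset.abs_sum_le_sum_abs _ _).trans (Finset.sum_le_sum fun t ht => ?_)
  rw [abs_mul, abs_of_nonneg (kernelWeight_nonneg hK_nonneg n hb _ _)]
  by_cases hW : kernelWeight K n b (a t) u = 0
  · rw [hW, zero_mul, zero_mul]
  · have hlip := hh.dist_le_mul (a t) (ha t ht) u hu
    rw [Real.dist_eq, Real.dist_eq] at hlip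
    have := abs_sub_le_of_kernelWeight_ne_zero hK_supp hb hW
    exact mul_le_mul_of_nonneg_left (hlip.trans (by gcongr))
      (kernelWeight_nonneg hK_nonneg n hb _ _)

variable {a c x : ℕ → ℝ} {σ : ℝ}

lemma sum_abs_kernelWeight_sub_le {u u' ρ : ℝ} (hK_lip : LipschitzWith Lk K) (hn : 0 < n)
    (hb : 0 < b) (hσ : ∑ t ∈ Finset.Icc 1 n, |c t - a t| ≤ n * σ) (hρ : |u' - u| ≤ ρ) :
    ∑ t ∈ Finset.Icc 1 n, |kernelWeight K n b (c t) u' - kernelWeight K n b (a t) u| ≤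
      Lk * ((σ + ρ) / b ^ 2) := by
  calc ∑ t ∈ Finset.Icc 1 n, |kernelWeight K n b (c t) u' - kernelWeight K n b (a t) u|
      ≤ ∑ t ∈ Finset.Icc 1 n, Lk / (n * b ^ 2) * (|c t - a t| + ρ) := by
        refine Finset.sum_le_sum fun t _ => (abs_kernelWeight_sub_le hK_lip n hb _ _ _ _).trans ?_
        gcongr
    _ = Lk / (n * b ^ 2) * (∑ t ∈ Finset.Icc 1 n, |c t - a t| + n * ρ) := by
        rw [← Finset.mul_sum, Finset.sum_add_distrib, Finset.sum_const, nsmul_eq_mul,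
          Nat.card_Icc, Nat.add_sub_cancel]
    _ ≤ Lk / (n * b ^ 2) * (n * σ + n * ρ) := by gcongr
    _ = Lk * ((σ + ρ) / b ^ 2) := by field_simp

lemma abs_sum_kernelWeight_mul_residual_sub_le {u L R : ℝ} (hK_nonneg : ∀ z, 0 ≤ K z)
    (hK_supp : ∀ z, z ∉ Set.Icc (-(1 / 2) : ℝ) (1 / 2) → K z = 0)
    (hK_lip : LipschitzWith Lk K) (hn : 0 < n) (hb : 0 < b)
    (hL : ∀ t ∈ Finset.Icc 1 n, |x t - a t| ≤ L) (hR : ∀ t ∈ Finset.Icc 1 n, |c t - a t| ≤ R)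
    (hσ : ∑ t ∈ Finset.Icc 1 n, |c t - a t| ≤ n * σ) :
    |∑ t ∈ Finset.Icc 1 n, kernelWeight K n b (c t) u * ((x t - c t) ^ 2 - (x t - a t) ^ 2)| ≤
      Lk * ((2 * L + R) * (σ / b)) := by
  have hone : 1 ∈ Finset.Icc 1 n := Finset.mem_Icc.2 ⟨le_rfl, hn⟩
  have hL_nonneg : 0 ≤ L := (abs_nonneg _).trans (hL 1 hone)
  have hR_nonneg : 0 ≤ R := (abs_nonneg _).trans (hR 1 hone)
  have hsq : ∀ t ∈ Finset.Icc 1 n,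
      |(x t - c t) ^ 2 - (x t - a t) ^ 2| ≤ (2 * L + R) * |c t - a t| := by
    intro t ht
    rw [show (x t - c t) ^ 2 - (x t - a t) ^ 2 =
      (c t - a t - 2 * (x t - a t)) * (c t - a t) by ring, abs_mul]
    refine mul_le_mul_of_nonneg_right ((abs_sub _ _).trans ?_) (abs_nonneg _)
    rw [abs_mul, abs_two]
    linarith [hL t ht, hR t ht]
  calc |∑ t ∈ Finset.Icc 1 n, kernelWeight K n b (c t) u * ((x t - c t) ^ 2 - (x t - a t) ^ 2)|
      ≤ ∑ t ∈ Finset.Icc 1 n, Lk / (n * b) * ((2 * L + R) * |c t - a t|) := by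
        refine (Finset.abs_sum_le_sum_abs _ _).trans (Finset.sum_le_sum fun t ht => ?_)
        rw [abs_mul, abs_of_nonneg (kernelWeight_nonneg hK_nonneg n hb _ _)]
        exact mul_le_mul (kernelWeight_le hK_lip hK_supp n hb _ _) (hsq t ht) (abs_nonneg _)
          (by positivity)
    _ = Lk / (n * b) * ((2 * L + R) * ∑ t ∈ Finset.Icc 1 n, |c t - a t|) := by
        rw [← Finset.mul_sum, ← Finset.mul_sum]
    _ ≤ Lk / (n * b) * ((2 * L + R) * (n * σ)) := by gcongr
    _ = Lk * ((2 * L + R) * (σ / b)) := by field_simp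

end KernelRegression

section TypicalSample

/-- The data vector `x` is close to the signal `a` and its squared noise to the variances `v`:
the noise is at most `L`, the moving averages of half-width `M` deviate from those of `a` by at
most `A`, the local mean with weights `w` by at most `ρ`, and the kernel smoother of the squared
noise at the local mean of `a` by at most `T`. -/
structure IsTypical (K : ℝ → ℝ) (n M : ℕ) (b : ℝ) (w a v : ℕ → ℝ) (L A ρ T : ℝ) (x : ℕ → ℝ) :
    Prop where
  noise_le : ∀ t ∈ Finset.Icc 1 n, |x t - a t| ≤ L
  window_le : ∀ t ∈ interior n M,
    |localMean n (windowWeight M t) x - localMean n (windowWeight M t) a| ≤ A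
  localMean_le : |localMean n w x - localMean n w a| ≤ ρ
  sqNoise_le : |∑ t ∈ Finset.Icc 1 n, kernelWeight K n b (a t) (localMean n w a) *
    ((x t - a t) ^ 2 - v t)| ≤ T

/-- A bound for the mean absolute error of the preliminary estimator, for noise bounded by `L`,
deviations of the moving averages bounded by `A` and a signal of total variation at most `V`. -/
noncomputable def prelimErrorBound (n M : ℕ) (V L A : ℝ) : ℝ :=
  A + 2 * M * (2 * V + L) / n

/-- A bound for the error of `hHat`, in terms of the mean error `σ` of the preliminary estimator
and of the parameters of `IsTypical`; `Lk` and `H` are Lipschitz constants of the kernel and of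
the variance function, `hm` bounds the latter, and `c₁` is the lower bound for the design. -/
noncomputable def hHatErrorBound (Lk H V hm c₁ b σ L ρ T : ℝ) : ℝ :=
  2 / c₁ * (Lk * ((3 * L + V) * (σ / b)) + Lk * ((σ + ρ) / b ^ 2) * (L ^ 2 + hm) + T) +
    2 * (H * b)

lemma IsTypical.abs_hHat_sub_le {K h : ℝ → ℝ} {n M : ℕ} {b : ℝ} {pad : ℤ → ℕ}
    {w a x : ℕ → ℝ} {S : Set ℝ} {Lk H V : ℝ≥0} {hm c₁ L A ρ T : ℝ}
    (hx : IsTypical K n M b w a (fun t => h (a t)) L A ρ T x) (hn : 0 < n) (hb : 0 < b)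
    (hpad : IsBoundaryRule n pad) (hK_nonneg : ∀ z, 0 ≤ K z)
    (hK_supp : ∀ z, z ∉ Set.Icc (-(1 / 2) : ℝ) (1 / 2) → K z = 0)
    (hK_lip : LipschitzWith Lk K) (ha_var : eVariationOn a (Set.Icc 1 n) ≤ V) (hA : 0 ≤ A)
    (hh : LipschitzOnWith H h S) (hh_le : ∀ y ∈ S, |h y| ≤ hm)
    (ha : ∀ t ∈ Finset.Icc 1 n, a t ∈ S) (hu : localMean n w a ∈ S) (hc₁ : 0 < c₁)
    (hdesign : c₁ ≤ ∑ t ∈ Finset.Icc 1 n, kernelWeight K n b (a t) (localMean n w a))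
    (hsmall : Lk * ((prelimErrorBound n M V L A + ρ) / b ^ 2) ≤ c₁ / 2) :
    |hHat K n M b pad x (localMean n w x) - h (localMean n w a)| ≤
      hHatErrorBound Lk H V hm c₁ b (prelimErrorBound n M V L A) L ρ T := by
  have hL : 0 ≤ L := (abs_nonneg _).trans (hx.noise_le 1 (Finset.mem_Icc.2 ⟨le_rfl, hn⟩))
  have hprelim : ∀ t ∈ Finset.Icc 1 n, |prelim M pad x t - a t| ≤ L + V := fun t ht =>
    abs_prelim_sub_le_of_eVariationOn_le hpad ha_var hx.noise_le ht
  have hσ : ∑ t ∈ Finset.Icc 1 n, |prelim M pad x t - a t| ≤ n * prelimErrorBound n M V L A := by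
    refine (sum_abs_prelim_sub_le (M := M) hpad ha_var hA hL hx.noise_le fun t ht => ?_).trans_eq ?_
    · rw [prelim_eq_localMean hpad ht, prelim_eq_localMean hpad ht]
      exact hx.window_le t ht
    · rw [prelimErrorBound]
      field_simp
  have hweights := sum_abs_kernelWeight_sub_le hK_lip hn hb hσ hx.localMean_le
  have hsq_le : ∀ t ∈ Finset.Icc 1 n, |(x t - a t) ^ 2 - h (localMean n w a)| ≤ L ^ 2 + hm := by
    intro t ht
    refine (abs_sub _ _).trans (add_le_add ?_ (hh_le _ hu))
    rw [abs_pow]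
    exact pow_le_pow_left₀ (abs_nonneg _) (hx.noise_le t ht) 2
  have hhm : 0 ≤ L ^ 2 + hm := (abs_nonneg _).trans (hsq_le 1 (Finset.mem_Icc.2 ⟨le_rfl, hn⟩))
  have hresidual := abs_sum_kernelWeight_mul_residual_sub_le (u := localMean n w x) hK_nonneg
    hK_supp hK_lip hn hb hx.noise_le hprelim hσ
  rw [show 2 * L + (L + V) = 3 * L + V by ring] at hresidual
  exact abs_sum_mul_div_sum_sub_le hc₁ hdesign (hweights.trans hsmall) hresidual
    ((abs_sum_mul_le_sum_abs_mul hsq_le).trans (mul_le_mul_of_nonneg_right hweights hhm))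
    hx.sqNoise_le (abs_sum_kernelWeight_mul_sub_le hK_nonneg hK_supp hb hh ha hu)

end TypicalSample

section RandomSample

variable {Ω : Type*} {_ : MeasurableSpace Ω} {μ : Measure Ω} {n M : ℕ} {X : ℕ → Ω → ℝ}
  {w a v : ℕ → ℝ} {B L V W b m q : ℝ}

/-- `X 1, …, X n` are independent with means `a t`, variances `v t` and fourth central moments
at most `m`. -/
structure IsSample (μ : Measure Ω) (n : ℕ) (X : ℕ → Ω → ℝ) (a v : ℕ → ℝ) (m : ℝ) : Prop where
  measurable : ∀ t ∈ Finset.Icc 1 n, Measurable (X t)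
  indep : iIndepFun (fun t : Finset.Icc 1 n => X t) μ
  memLp : ∀ t ∈ Finset.Icc 1 n, MemLp (X t) 4 μ
  mean : ∀ t ∈ Finset.Icc 1 n, ∫ ω, X t ω ∂μ = a t
  variance : ∀ t ∈ Finset.Icc 1 n, variance (X t) μ = v t
  fourth_moment_le : ∀ t ∈ Finset.Icc 1 n, ∫ ω, (X t ω - a t) ^ 4 ∂μ ≤ m

/-- Nonnegative weights on a sample of size `n` that sum to one and whose sum of squares is at
most `V`. -/
structure IsAveragingWeight (n : ℕ) (V : ℝ) (w : ℕ → ℝ) : Prop where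
  nonneg : ∀ t ∈ Finset.Icc 1 n, 0 ≤ w t
  sum_one : ∑ t ∈ Finset.Icc 1 n, w t = 1
  sum_sq_le : ∑ t ∈ Finset.Icc 1 n, w t ^ 2 ≤ V

/-- The size below which a centred weighted sum over a sample of size `n` stays with probability
at least `1 - 2 / n ^ 3`, on an event where the summands are bounded by `B` and whose complement
has probability at most `q`. Here `V` bounds the sum of the squared weights, `W` their sum, and
`m` the second moments of the summands. -/
noncomputable def deviationBound (n : ℕ) (B V W m q : ℝ) : ℝ :=
  B * √(6 * Real.log n * V) + W * √(m * q)

/-- `prelimErrorBound` for a sample with fourth moments at most `m`, the moving averages of the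
noise being controlled by `deviationBound`. -/
noncomputable def prelimDeviationBound (n M : ℕ) (V L m q : ℝ) : ℝ :=
  prelimErrorBound n M V L (deviationBound n L (1 / (2 * M + 1)) 1 (1 + m) q)

/-- `deviationBound` for the kernel smoother of the squared noise of a sample with fourth moments
at most `m`, in terms of the Lipschitz constant `Lk` of the kernel: this constant bounds the kernel,
so the weights are at most `Lk / (n * b)`. -/
noncomputable def sqNoiseDeviationBound (n : ℕ) (Lk b L m q : ℝ) : ℝ :=
  deviationBound n (L ^ 2) (n * (Lk / (n * b)) ^ 2) (n * (Lk / (n * b))) (1 + m) q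

lemma isAveragingWeight_windowWeight {t : ℕ} (ht : t ∈ interior n M) :
    IsAveragingWeight n (1 / (2 * M + 1)) (windowWeight M t) :=
  ⟨fun q _ => windowWeight_nonneg M t q, sum_windowWeight ht, (sum_windowWeight_sq ht).le⟩

lemma deviationBound_nonneg (hB : 0 ≤ B) (hW : 0 ≤ W) : 0 ≤ deviationBound n B V W m q := by
  unfold deviationBound
  positivity

lemma measureReal_deviationBound_lt_le [IsProbabilityMeasure μ] {Y : ℕ → Ω → ℝ} {A : Set Ω}
    (hn : 0 < n) (hY : ∀ t ∈ Finset.Icc 1 n, Measurable (Y t))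
    (hind : iIndepFun (fun t : Finset.Icc 1 n => Y t) μ)
    (hL2 : ∀ t ∈ Finset.Icc 1 n, MemLp (Y t) 2 μ)
    (hm : ∀ t ∈ Finset.Icc 1 n, ∫ ω, Y t ω ^ 2 ∂μ ≤ m)
    (hA : ∀ ω ∈ A, ∀ t ∈ Finset.Icc 1 n, |Y t ω| ≤ B) (hq : μ.real Aᶜ ≤ q) (hB : 0 < B)
    (hw : ∀ t ∈ Finset.Icc 1 n, 0 ≤ w t) (hw_pos : 0 < ∑ t ∈ Finset.Icc 1 n, w t)
    (hV : ∑ t ∈ Finset.Icc 1 n, w t ^ 2 ≤ V) (hW : ∑ t ∈ Finset.Icc 1 n, w t ≤ W) :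
    μ.real (A ∩ {ω | deviationBound n B V W m q <
      |∑ t ∈ Finset.Icc 1 n, w t * (Y t ω - ∫ ω', Y t ω' ∂μ)|}) ≤ 2 / (n : ℝ) ^ 3 := by
  have hn' : (0 : ℝ) < n := by exact_mod_cast hn
  have hsum (F : ℕ → ℝ) : ∑ t : Finset.Icc 1 n, F t = ∑ t ∈ Finset.Icc 1 n, F t :=
    Finset.sum_coe_sort _ F
  have habs : ∑ t ∈ Finset.Icc 1 n, |w t| = ∑ t ∈ Finset.Icc 1 n, w t :=
    Finset.sum_congr rfl fun t ht => abs_of_nonneg (hw t ht)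
  have hsq_pos : 0 < ∑ t ∈ Finset.Icc 1 n, w t ^ 2 := by
    obtain ⟨t, ht, hwt⟩ := Finset.exists_ne_zero_of_sum_ne_zero hw_pos.ne'
    exact Finset.sum_pos' (fun t _ => sq_nonneg _) ⟨t, ht, by positivity⟩
  have hthreshold : B * √(2 * (3 * Real.log n) * ∑ t ∈ Finset.Icc 1 n, w t ^ 2) +
      (∑ t ∈ Finset.Icc 1 n, |w t|) * √(m * q) ≤ deviationBound n B V W m q := by
    rw [habs, deviationBound, show 2 * (3 * Real.log n) = 6 * Real.log n by ring]
    gcongr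
  have htail (t : Finset.Icc 1 n) : μ.real {ω | |Y t ω| ≤ B}ᶜ ≤ q :=
    (measureReal_mono (Set.compl_subset_compl.2 fun ω hω => hA ω hω t t.2)).trans hq
  have htail_le := measureReal_lt_abs_sum_mul_sub_integral_le (Y := fun t : Finset.Icc 1 n => Y t)
    (w := fun t => w t) (r := 3 * Real.log n) (fun t => hY t t.2) hind (fun t => hL2 t t.2)
    (fun t => hm t t.2) htail hB (hsq_pos.trans_eq (hsum fun t => w t ^ 2).symm) (by positivity)
  simp only [hsum fun t => w t ^ 2, hsum fun t => |w t|,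
    fun ω => hsum fun t => w t * (Y t ω - ∫ ω', Y t ω' ∂μ)] at htail_le
  refine (measureReal_mono ?_).trans (htail_le.trans_eq ?_)
  · rintro ω ⟨hω, hlt⟩
    exact ⟨fun t => hA ω hω t t.2, hthreshold.trans_lt hlt⟩
  · rw [Real.exp_neg, mul_comm 3, Real.exp_mul, Real.exp_log hn', div_eq_mul_inv]
    norm_cast

namespace IsSample

lemma memLp_noise [IsFiniteMeasure μ] (hX : IsSample μ n X a v m) {t : ℕ}
    (ht : t ∈ Finset.Icc 1 n) : MemLp (fun ω => X t ω - a t) 4 μ :=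
  (hX.memLp t ht).sub (memLp_const _)

lemma memLp_two_noise [IsFiniteMeasure μ] (hX : IsSample μ n X a v m) {t : ℕ}
    (ht : t ∈ Finset.Icc 1 n) : MemLp (fun ω => X t ω - a t) 2 μ :=
  (hX.memLp_noise ht).mono_exponent (by norm_num)

lemma integral_noise [IsProbabilityMeasure μ] (hX : IsSample μ n X a v m) {t : ℕ}
    (ht : t ∈ Finset.Icc 1 n) : ∫ ω, (X t ω - a t) ∂μ = 0 := by
  rw [integral_sub ((hX.memLp t ht).integrable (by norm_num)) (integrable_const _), hX.mean t ht]
  simp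

lemma integral_noise_sq (hX : IsSample μ n X a v m) {t : ℕ} (ht : t ∈ Finset.Icc 1 n) :
    ∫ ω, (X t ω - a t) ^ 2 ∂μ = v t := by
  rw [← hX.variance t ht, variance_eq_integral (hX.measurable t ht).aemeasurable, hX.mean t ht]

lemma integrable_noise_pow_four [IsFiniteMeasure μ] (hX : IsSample μ n X a v m) {t : ℕ}
    (ht : t ∈ Finset.Icc 1 n) : Integrable (fun ω => (X t ω - a t) ^ 4) μ :=
  ((hX.memLp_noise ht).integrable_norm_pow (p := 4) (by norm_num)).congr <| ae_of_all _ fun ω => by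
    simp only [Real.norm_eq_abs, Even.pow_abs (by decide : Even 4)]

lemma memLp_two_noise_sq [IsFiniteMeasure μ] (hX : IsSample μ n X a v m) {t : ℕ}
    (ht : t ∈ Finset.Icc 1 n) : MemLp (fun ω => (X t ω - a t) ^ 2) 2 μ := by
  rw [memLp_two_iff_integrable_sq
    (((hX.measurable t ht).sub_const _).pow_const 2).aestronglyMeasurable]
  simpa only [← pow_mul] using hX.integrable_noise_pow_four ht

lemma integral_noise_sq_le [IsProbabilityMeasure μ] (hX : IsSample μ n X a v m) {t : ℕ}
    (ht : t ∈ Finset.Icc 1 n) : ∫ ω, (X t ω - a t) ^ 2 ∂μ ≤ 1 + m := by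
  have hint := hX.integrable_noise_pow_four ht
  calc ∫ ω, (X t ω - a t) ^ 2 ∂μ
      ≤ ∫ ω, (1 + (X t ω - a t) ^ 4) ∂μ :=
        integral_mono (hX.memLp_two_noise ht).integrable_sq ((integrable_const 1).add hint)
          fun ω => by nlinarith [sq_nonneg ((X t ω - a t) ^ 2 - 1)]
    _ = 1 + ∫ ω, (X t ω - a t) ^ 4 ∂μ := by
        rw [integral_add (integrable_const 1) hint]
        simp
    _ ≤ 1 + m := by gcongr; exact hX.fourth_moment_le t ht

lemma measureReal_deviationBound_lt_localMean_le [IsProbabilityMeasure μ]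
    (hX : IsSample μ n X a v m) (hn : 0 < n) (hL : 0 < L)
    (hq : μ.real {ω | ∀ t ∈ Finset.Icc 1 n, |X t ω - a t| ≤ L}ᶜ ≤ q)
    (hw : IsAveragingWeight n V w) :
    μ.real ({ω | ∀ t ∈ Finset.Icc 1 n, |X t ω - a t| ≤ L} ∩ {ω | deviationBound n L V 1 (1 + m) q <
      |localMean n w (fun t => X t ω) - localMean n w a|}) ≤ 2 / (n : ℝ) ^ 3 := by
  refine (measureReal_mono (Set.inter_subset_inter_right _ fun ω hω => hω.out.trans_eq ?_)).trans
    (measureReal_deviationBound_lt_le (Y := fun t ω => X t ω - a t) hn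
      (fun t ht => (hX.measurable t ht).sub_const _)
      (hX.indep.comp (fun t x => x - a t) fun t => by fun_prop) (fun t ht => hX.memLp_two_noise ht)
      (fun t ht => hX.integral_noise_sq_le ht) (fun ω hω => hω) hq hL hw.nonneg
      (hw.sum_one ▸ one_pos) hw.sum_sq_le hw.sum_one.le)
  rw [localMean, localMean, ← Finset.sum_sub_distrib]
  congr 1
  refine Finset.sum_congr rfl fun t ht => ?_
  rw [hX.integral_noise ht, sub_zero, mul_sub]

lemma measureReal_deviationBound_lt_sqNoise_le [IsProbabilityMeasure μ] {c : ℝ}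
    (hX : IsSample μ n X a v m) (hn : 0 < n) (hL : 0 < L)
    (hq : μ.real {ω | ∀ t ∈ Finset.Icc 1 n, |X t ω - a t| ≤ L}ᶜ ≤ q)
    (hw : ∀ t ∈ Finset.Icc 1 n, 0 ≤ w t) (hw_le : ∀ t ∈ Finset.Icc 1 n, w t ≤ c)
    (hw_pos : 0 < ∑ t ∈ Finset.Icc 1 n, w t) :
    μ.real ({ω | ∀ t ∈ Finset.Icc 1 n, |X t ω - a t| ≤ L} ∩
      {ω | deviationBound n (L ^ 2) (n * c ^ 2) (n * c) (1 + m) q <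
        |∑ t ∈ Finset.Icc 1 n, w t * ((X t ω - a t) ^ 2 - v t)|}) ≤ 2 / (n : ℝ) ^ 3 := by
  have hm : ∀ t ∈ Finset.Icc 1 n, ∫ ω, ((X t ω - a t) ^ 2) ^ 2 ∂μ ≤ 1 + m := fun t ht => by
    simp only [← pow_mul]
    exact (hX.fourth_moment_le t ht).trans (le_add_of_nonneg_left zero_le_one)
  refine (measureReal_mono (Set.inter_subset_inter_right _ fun ω hω => hω.out.trans_eq ?_)).trans
    (measureReal_deviationBound_lt_le (Y := fun t ω => (X t ω - a t) ^ 2) hn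
      (fun t ht => ((hX.measurable t ht).sub_const _).pow_const 2)
      (hX.indep.comp (fun t x => (x - a t) ^ 2) fun t => by fun_prop)
      (fun t ht => hX.memLp_two_noise_sq ht) hm (fun ω hω t ht => ?_) hq (by positivity) hw
      hw_pos ?_ ?_)
  · congr 1
    refine Finset.sum_congr rfl fun t ht => ?_
    rw [hX.integral_noise_sq ht]
  · rw [abs_pow]
    exact pow_le_pow_left₀ (abs_nonneg _) (hω.out t ht) 2
  · simpa using Finset.sum_le_card_nsmul _ _ _ fun t ht => pow_le_pow_left₀ (hw t ht) (hw_le t ht) 2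
  · simpa using Finset.sum_le_card_nsmul _ _ _ hw_le

lemma measureReal_not_isTypical_le [IsProbabilityMeasure μ] {K : ℝ → ℝ} {Lk : ℝ≥0}
    (hX : IsSample μ n X a v m) (hn : 0 < n) (hb : 0 < b) (hL : 0 < L)
    (hK_nonneg : ∀ z, 0 ≤ K z)
    (hK_supp : ∀ z, z ∉ Set.Icc (-(1 / 2) : ℝ) (1 / 2) → K z = 0) (hK_lip : LipschitzWith Lk K)
    (hw : IsAveragingWeight n V w)
    (hdesign : 0 < ∑ t ∈ Finset.Icc 1 n, kernelWeight K n b (a t) (localMean n w a))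
    (hq : μ.real {ω | ∀ t ∈ Finset.Icc 1 n, |X t ω - a t| ≤ L}ᶜ ≤ q) :
    μ.real {ω | ¬ IsTypical K n M b w a v L (deviationBound n L (1 / (2 * M + 1)) 1 (1 + m) q)
        (deviationBound n L V 1 (1 + m) q)
        (sqNoiseDeviationBound n Lk b L m q) fun t => X t ω} ≤ q + 6 / (n : ℝ) ^ 2 := by
  set G : Set Ω := {ω | ∀ t ∈ Finset.Icc 1 n, |X t ω - a t| ≤ L}
  have hn1 : (1 : ℝ) ≤ n := by exact_mod_cast hn
  have hwindow (t : ℕ) (ht : t ∈ interior n M) := hX.measureReal_deviationBound_lt_localMean_le hn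
    hL hq (isAveragingWeight_windowWeight ht)
  have hmean := hX.measureReal_deviationBound_lt_localMean_le hn hL hq hw
  have hsq := hX.measureReal_deviationBound_lt_sqNoise_le hn hL hq
    (fun t _ => kernelWeight_nonneg hK_nonneg n hb (a t) (localMean n w a))
    (fun t _ => kernelWeight_le hK_lip hK_supp n hb (a t) (localMean n w a)) hdesign
  have hwindows := (measureReal_biUnion_finset_le (μ := μ) (interior n M) _).trans
    (Finset.sum_le_card_nsmul _ _ _ hwindow)
  have hcard : (interior n M).card • (2 / (n : ℝ) ^ 3) ≤ 2 / (n : ℝ) ^ 2 := by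
    have hle : ((interior n M).card : ℝ) ≤ n := by
      simpa using Finset.card_le_card (interior_subset n M)
    calc (interior n M).card • (2 / (n : ℝ) ^ 3)
        ≤ n * (2 / (n : ℝ) ^ 3) := by rw [nsmul_eq_mul]; gcongr
      _ = 2 / (n : ℝ) ^ 2 := by field_simp
  have hpow : 2 / (n : ℝ) ^ 3 ≤ 2 / (n : ℝ) ^ 2 := by gcongr; norm_num
  have hunion := (measureReal_union_le Gᶜ _).trans <| add_le_add hq <|
    (measureReal_union_le _ _).trans <| add_le_add (hwindows.trans hcard) <|
    (measureReal_union_le _ _).trans <| add_le_add (hmean.trans hpow) (hsq.trans hpow)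
  refine (measureReal_mono fun ω hω => ?_).trans (hunion.trans_eq (by ring))
  by_contra hgood
  simp only [Set.mem_union, Set.mem_compl_iff, Set.mem_iUnion, Set.mem_inter_iff, not_or, not_not,
    not_exists, not_and] at hgood
  obtain ⟨hG, hwin, hmn, hs⟩ := hgood
  exact hω.out ⟨hG, fun t ht => not_lt.1 (hwin t ht hG), not_lt.1 (hmn hG), not_lt.1 (hs hG)⟩

lemma measureReal_le_abs_hHat_sub_le [IsProbabilityMeasure μ] {K h : ℝ → ℝ} {pad : ℤ → ℕ}
    {S : Set ℝ} {Lk H Va : ℝ≥0} {hm c₁ δ : ℝ} (hX : IsSample μ n X a (fun t => h (a t)) m)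
    (hn : 0 < n) (hb : 0 < b) (hL : 0 < L) (hpad : IsBoundaryRule n pad)
    (hK_nonneg : ∀ z, 0 ≤ K z)
    (hK_supp : ∀ z, z ∉ Set.Icc (-(1 / 2) : ℝ) (1 / 2) → K z = 0) (hK_lip : LipschitzWith Lk K)
    (ha_var : eVariationOn a (Set.Icc 1 n) ≤ Va) (hh : LipschitzOnWith H h S)
    (hh_le : ∀ y ∈ S, |h y| ≤ hm) (ha : ∀ t ∈ Finset.Icc 1 n, a t ∈ S)
    (hw : IsAveragingWeight n V w) (hu : localMean n w a ∈ S) (hc₁ : 0 < c₁)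
    (hdesign : c₁ ≤ ∑ t ∈ Finset.Icc 1 n, kernelWeight K n b (a t) (localMean n w a))
    (hq : μ.real {ω | ∀ t ∈ Finset.Icc 1 n, |X t ω - a t| ≤ L}ᶜ ≤ q)
    (hsmall : Lk * ((prelimDeviationBound n M Va L m q + deviationBound n L V 1 (1 + m) q) /
      b ^ 2) ≤ c₁ / 2)
    (hδ : hHatErrorBound Lk H Va hm c₁ b (prelimDeviationBound n M Va L m q) L
      (deviationBound n L V 1 (1 + m) q) (sqNoiseDeviationBound n Lk b L m q) < δ) :
    μ.real {ω | δ ≤ |hHat K n M b pad (fun t => X t ω) (localMean n w fun t => X t ω) -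
      h (localMean n w a)|} ≤ q + 6 / (n : ℝ) ^ 2 := by
  refine (measureReal_mono fun ω hω hω_typical => ?_).trans
    (hX.measureReal_not_isTypical_le (M := M) hn hb hL hK_nonneg hK_supp hK_lip hw
      (hc₁.trans_le hdesign) hq)
  exact (hδ.trans_le hω).not_ge <| hω_typical.abs_hHat_sub_le hn hb hpad hK_nonneg hK_supp hK_lip
    ha_var (deviationBound_nonneg hL.le zero_le_one) hh hh_le ha hu hc₁ hdesign hsmall

lemma measurableSet_noise_le (hX : IsSample μ n X a v m) (L : ℝ) :
    MeasurableSet {ω | ∀ t ∈ Finset.Icc 1 n, |X t ω - a t| ≤ L} := by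
  rw [show {ω | ∀ t ∈ Finset.Icc 1 n, |X t ω - a t| ≤ L} =
    ⋂ t ∈ Finset.Icc 1 n, {ω | |X t ω - a t| ≤ L} by ext ω; simp]
  exact Finset.measurableSet_biInter _ fun t ht =>
    measurableSet_le ((hX.measurable t ht).sub_const _).abs measurable_const

end IsSample

end RandomSample

section PolynomialOrder

variable {ι : Type*} {l : Filter ι} {e e' : ℝ} {N f g : ι → ℝ}

/-- `f` has polynomial order at most `e` in the scale `N`: it is `O(N ^ e')` for every `e' > e`, so
that powers of `log N` have order `0`. -/
def HasOrderLE (l : Filter ι) (N f : ι → ℝ) (e : ℝ) : Prop :=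
  ∀ e' > e, f =O[l] fun i => N i ^ e'

namespace HasOrderLE

lemma mono (hf : HasOrderLE l N f e) (h : e ≤ e') : HasOrderLE l N f e' :=
  fun r hr => hf r (h.trans_lt hr)

lemma of_isBigO (hN : Tendsto N l atTop) (hf : f =O[l] fun i => N i ^ e) : HasOrderLE l N f e :=
  fun r hr => hf.trans <| IsBigO.of_bound' <| (hN.eventually_ge_atTop 1).mono fun i hi => by
    have hi0 := zero_le_one.trans hi
    rw [Real.norm_of_nonneg (Real.rpow_nonneg hi0 _), Real.norm_of_nonneg (Real.rpow_nonneg hi0 _)]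
    exact Real.rpow_le_rpow_of_exponent_le hi (le_of_lt hr)

lemma const (hN : Tendsto N l atTop) (c : ℝ) : HasOrderLE l N (fun _ => c) 0 :=
  of_isBigO hN <| by simpa only [Real.rpow_zero] using isBigO_const_const c one_ne_zero l

lemma self (hN : Tendsto N l atTop) : HasOrderLE l N N 1 :=
  of_isBigO hN <| by simpa only [Real.rpow_one] using isBigO_refl N l

lemma log_rpow (hN : Tendsto N l atTop) (d : ℝ) :
    HasOrderLE l N (fun i => Real.log (N i) ^ d) 0 :=
  fun _ hr => ((isLittleO_log_rpow_rpow_atTop d hr).comp_tendsto hN).isBigO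

lemma inv_of_isBigO (hN : Tendsto N l atTop) (hf : (fun i => N i ^ e) =O[l] f) :
    HasOrderLE l N (fun i => (f i)⁻¹) (-e) := by
  have hpos := hN.eventually_gt_atTop 0
  refine of_isBigO hN ((hf.inv_rev (hpos.mono fun i hi h => ?_)).congr' .rfl
    (hpos.mono fun i hi => ?_))
  · exact absurd h (Real.rpow_pos_of_pos hi _).ne'
  · exact (Real.rpow_neg hi.le _).symm

lemma inv_self (hN : Tendsto N l atTop) : HasOrderLE l N (fun i => (N i)⁻¹) (-1) :=
  inv_of_isBigO hN <| by simpa only [Real.rpow_one] using isBigO_refl N l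

lemma add (hf : HasOrderLE l N f e) (hg : HasOrderLE l N g e) :
    HasOrderLE l N (fun i => f i + g i) e :=
  fun r hr => (hf r hr).add (hg r hr)

lemma const_mul (c : ℝ) (hf : HasOrderLE l N f e) : HasOrderLE l N (fun i => c * f i) e :=
  fun r hr => (hf r hr).const_mul_left c

lemma mul (hN : Tendsto N l atTop) (hf : HasOrderLE l N f e) (hg : HasOrderLE l N g e') :
    HasOrderLE l N (fun i => f i * g i) (e + e') := by
  intro r hr
  have hf' := hf (e + (r - (e + e')) / 2) (by linarith)
  have hg' := hg (e' + (r - (e + e')) / 2) (by linarith)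
  refine (hf'.mul hg').congr' .rfl ((hN.eventually_gt_atTop 0).mono fun i hi => ?_)
  simp only [← Real.rpow_add hi]
  ring_nf

lemma sq (hN : Tendsto N l atTop) (hf : HasOrderLE l N f e) :
    HasOrderLE l N (fun i => f i ^ 2) (e + e) := by
  simpa only [pow_two] using hf.mul hN hf

lemma sqrt (hN : Tendsto N l atTop) (hf : HasOrderLE l N f e) :
    HasOrderLE l N (fun i => √(f i)) (e / 2) := by
  intro r hr
  have hpos := hN.eventually_gt_atTop 0
  refine ((hf (2 * r) (by linarith)).sqrt
    (hpos.mono fun i hi => Real.rpow_nonneg hi.le _)).congr' .rfl (hpos.mono fun i hi => ?_)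
  simp only [Real.sqrt_eq_rpow, ← Real.rpow_mul hi.le]
  ring_nf

lemma tendsto_zero (hN : Tendsto N l atTop) (hf : HasOrderLE l N f e) (he : e < 0) :
    Tendsto f l (nhds 0) := by
  refine (hf (e / 2) (by linarith)).trans_tendsto ?_
  simpa [Function.comp_def] using
    (tendsto_rpow_neg_atTop (y := -(e / 2)) (by linarith)).comp hN

lemma eventually_lt_log_rpow (hN : Tendsto N l atTop) (hf : HasOrderLE l N f e) (he : e < 0)
    {c : ℝ} (hc : 0 < c) (v : ℝ) : ∀ᶠ i in l, f i < c * Real.log (N i) ^ v := by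
  have hlim := (hf.mul hN (log_rpow hN (-v))).tendsto_zero hN (by linarith)
  filter_upwards [hlim.eventually_lt_const hc, hN.eventually_gt_atTop 1] with i hi hNi
  have hlog := Real.log_pos hNi
  rwa [Real.rpow_neg hlog.le, ← div_eq_mul_inv, div_lt_iff₀ (Real.rpow_pos_of_pos hlog _)] at hi

end HasOrderLE

end PolynomialOrder

section ErrorOrders

variable {ι : Type*} {l : Filter ι} {n M : ι → ℕ} {b B L V W q A σ ρ T : ι → ℝ} {e e' ζ ϑ : ℝ}

open HasOrderLE

lemma hasOrderLE_deviationBound (hn : Tendsto (fun i => (n i : ℝ)) l atTop) (m : ℝ) {eV eW r : ℝ}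
    (hB : HasOrderLE l (fun i => (n i : ℝ)) B 0) (hV : HasOrderLE l (fun i => (n i : ℝ)) V eV)
    (hW : HasOrderLE l (fun i => (n i : ℝ)) W eW) (hq : HasOrderLE l (fun i => (n i : ℝ)) q r)
    (he : eV / 2 ≤ e) (he' : eW + r / 2 ≤ e) :
    HasOrderLE l (fun i => (n i : ℝ)) (fun i => deviationBound (n i) (B i) (V i) (W i) m (q i))
      e := by
  have hlog := (log_rpow hn 1).const_mul 6
  simp only [Real.rpow_one] at hlog
  exact ((hB.mul hn ((hlog.mul hn hV).sqrt hn)).mono (by linarith)).add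
    ((hW.mul hn ((hq.const_mul m).sqrt hn)).mono he')

lemma hasOrderLE_prelimErrorBound (hn : Tendsto (fun i => (n i : ℝ)) l atTop) (V : ℝ)
    (hA : HasOrderLE l (fun i => (n i : ℝ)) A e) (hL : HasOrderLE l (fun i => (n i : ℝ)) L 0)
    (hM : HasOrderLE l (fun i => (n i : ℝ)) (fun i => (M i : ℝ)) ϑ) (he : ϑ - 1 ≤ e) :
    HasOrderLE l (fun i => (n i : ℝ)) (fun i => prelimErrorBound (n i) (M i) V (L i) (A i)) e := by
  have hedge := (((hM.const_mul 2).mul hn ((HasOrderLE.const hn (2 * V)).add hL)).mul hn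
    (inv_self hn)).mono (e' := e) (by linarith)
  simpa only [prelimErrorBound, div_eq_mul_inv] using hA.add hedge

lemma hasOrderLE_hHatErrorBound (hn : Tendsto (fun i => (n i : ℝ)) l atTop) (Lk H V hm c₁ : ℝ)
    (hb : HasOrderLE l (fun i => (n i : ℝ)) b (-ζ))
    (hb_inv : HasOrderLE l (fun i => (n i : ℝ)) (fun i => (b i)⁻¹) ζ) (hζ : 0 ≤ ζ)
    (hσ : HasOrderLE l (fun i => (n i : ℝ)) σ e) (hρ : HasOrderLE l (fun i => (n i : ℝ)) ρ e)
    (hL : HasOrderLE l (fun i => (n i : ℝ)) L 0) (hT : HasOrderLE l (fun i => (n i : ℝ)) T e')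
    (he : 2 * ζ + e ≤ e') (he' : -ζ ≤ e') :
    HasOrderLE l (fun i => (n i : ℝ))
      (fun i => hHatErrorBound Lk H V hm c₁ (b i) (σ i) (L i) (ρ i) (T i)) e' := by
  have hresidual := (((hL.const_mul 3).add (.const hn V)).mul hn (hσ.mul hn hb_inv)).const_mul Lk
  have hweights := (((hσ.add hρ).mul hn (hb_inv.sq hn)).const_mul Lk).mul hn
    (((hL.sq hn).mono (add_zero 0).le).add (.const hn hm))
  have hnumerator := ((hresidual.mono (e' := e') (by linarith)).add
    (hweights.mono (by linarith))).add hT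
  have := (hnumerator.const_mul (2 / c₁)).add (((hb.const_mul H).const_mul 2).mono he')
  simpa only [hHatErrorBound, div_eq_mul_inv, inv_pow] using this

end ErrorOrders

section Consistency

variable {ι : Type*} {l : Filter ι} {n M : ι → ℕ} {b L q : ι → ℝ} {α h : ℝ → ℝ} {H : ℝ≥0}
  {e ε ϑ ζ : ℝ}

open HasOrderLE

lemma hasOrderLE_prelimDeviationBound (hn : Tendsto (fun i => (n i : ℝ)) l atTop) (V m : ℝ)
    (hL : HasOrderLE l (fun i => (n i : ℝ)) L 0) (hq : HasOrderLE l (fun i => (n i : ℝ)) q (-2))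
    (hM : (fun i => (M i : ℝ)) =Θ[l] fun i => (n i : ℝ) ^ ϑ) (he : -ϑ / 2 ≤ e)
    (he' : ϑ - 1 ≤ e) :
    HasOrderLE l (fun i => (n i : ℝ))
      (fun i => prelimDeviationBound (n i) (M i) V (L i) m (q i)) e := by
  have hwindow : (fun i => (n i : ℝ) ^ ϑ) =O[l] fun i => 2 * (M i : ℝ) + 1 := by
    refine hM.isBigO_symm.trans (IsBigO.of_bound' (Eventually.of_forall fun i => ?_))
    rw [Real.norm_of_nonneg (by positivity), Real.norm_of_nonneg (by positivity)]
    linarith [(M i).cast_nonneg (α := ℝ)]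
  have hwindow_inv := inv_of_isBigO hn hwindow
  simp only [← one_div] at hwindow_inv
  exact hasOrderLE_prelimErrorBound hn V
    (hasOrderLE_deviationBound hn _ hL hwindow_inv (.const hn 1) hq he (by linarith)) hL
    (.of_isBigO hn hM.isBigO) he'

lemma hasOrderLE_sqNoiseDeviationBound (hn : Tendsto (fun i => (n i : ℝ)) l atTop) (Lk m : ℝ)
    (hL : HasOrderLE l (fun i => (n i : ℝ)) L 0) (hq : HasOrderLE l (fun i => (n i : ℝ)) q (-2))
    (hb_inv : HasOrderLE l (fun i => (n i : ℝ)) (fun i => (b i)⁻¹) ζ) :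
    HasOrderLE l (fun i => (n i : ℝ))
      (fun i => sqNoiseDeviationBound (n i) Lk (b i) (L i) m (q i)) (ζ - 1 / 2) := by
  have hweight : HasOrderLE l (fun i => (n i : ℝ)) (fun i => Lk / (n i * b i)) (-1 + ζ) := by
    simpa only [div_eq_mul_inv, mul_inv] using ((inv_self hn).mul hn hb_inv).const_mul Lk
  exact hasOrderLE_deviationBound hn _ ((hL.sq hn).mono (by norm_num))
    ((self hn).mul hn (hweight.sq hn)) ((self hn).mul hn hweight) hq (by linarith) (by linarith)

lemma eventually_errorBounds_lt (hn : Tendsto (fun i => (n i : ℝ)) l atTop)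
    (Lk H V hm m C : ℝ) {c c₁ : ℝ} (v : ℝ)
    (hL : HasOrderLE l (fun i => (n i : ℝ)) L 0) (hq : HasOrderLE l (fun i => (n i : ℝ)) q (-2))
    (hM : (fun i => (M i : ℝ)) =Θ[l] fun i => (n i : ℝ) ^ ϑ)
    (hb : b =Θ[l] fun i => (n i : ℝ) ^ (-ζ)) (hζ : 0 < ζ) (hζϑ : 4 * ζ < ϑ)
    (hζϑ' : 2 * ζ < 1 - ϑ) (hζε : 4 * ζ < ε) (hc : 0 < c) (hc₁ : 0 < c₁) :
    ∀ᶠ i in l,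
      Lk * ((prelimDeviationBound (n i) (M i) V (L i) m (q i) +
        deviationBound (n i) (L i) (C * (n i : ℝ) ^ (-ε)) 1 (1 + m) (q i)) / b i ^ 2) ≤ c₁ / 2 ∧
      hHatErrorBound Lk H V hm c₁ (b i) (prelimDeviationBound (n i) (M i) V (L i) m (q i)) (L i)
        (deviationBound (n i) (L i) (C * (n i : ℝ) ^ (-ε)) 1 (1 + m) (q i))
        (sqNoiseDeviationBound (n i) Lk (b i) (L i) m (q i)) < c * Real.log (n i) ^ v := by
  obtain ⟨e, ⟨heϑ, heϑ', heε⟩, he⟩ :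
      ∃ e, (-ϑ / 2 ≤ e ∧ ϑ - 1 ≤ e ∧ -ε / 2 ≤ e) ∧ 2 * ζ + e < 0 := by
    refine ⟨max (-ϑ / 2) (max (ϑ - 1) (-ε / 2)), by simp, ?_⟩
    rw [← lt_neg_iff_add_neg', max_lt_iff, max_lt_iff]
    refine ⟨?_, ?_, ?_⟩ <;> linarith
  obtain ⟨e', ⟨hee', hζe'⟩, he'⟩ : ∃ e', (2 * ζ + e ≤ e' ∧ -ζ ≤ e') ∧ e' < 0 :=
    ⟨max (2 * ζ + e) (-ζ), by simp, max_lt he (by linarith)⟩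
  have hb_inv : HasOrderLE l (fun i => (n i : ℝ)) (fun i => (b i)⁻¹) ζ := by
    simpa only [neg_neg] using inv_of_isBigO hn hb.isBigO_symm
  have hσ := hasOrderLE_prelimDeviationBound hn V m hL hq hM heϑ heϑ'
  have hpow : HasOrderLE l (fun i => (n i : ℝ)) (fun i => C * (n i : ℝ) ^ (-ε)) (-ε) :=
    (of_isBigO hn (isBigO_refl _ l)).const_mul C
  have hρ := hasOrderLE_deviationBound (e := e) hn (1 + m) hL hpow (.const hn 1) hq heε
    (by linarith)
  have hT := (hasOrderLE_sqNoiseDeviationBound hn Lk m hL hq hb_inv).mono (e' := e') (by linarith)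
  have herror := hasOrderLE_hHatErrorBound hn Lk H V hm c₁ (of_isBigO hn hb.isBigO) hb_inv hζ.le hσ
    hρ hL hT hee' hζe'
  have hshift := ((hσ.add hρ).mul hn (hb_inv.sq hn)).const_mul Lk
  simp only [inv_pow, ← div_eq_mul_inv] at hshift
  exact ((hshift.tendsto_zero hn (by linarith)).eventually_le_const (half_pos hc₁)).and
    (herror.eventually_lt_log_rpow hn he' hc v)

lemma exists_abs_le_of_lipschitzOnWith_signalRange (hα : BoundedVariationOn α (Set.Icc 0 1))
    (hh : LipschitzOnWith H h (signalRange α)) : ∃ B, ∀ y ∈ signalRange α, |h y| ≤ B := by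
  have h0 : (0 : ℝ) ∈ Set.Icc (0 : ℝ) 1 := ⟨le_rfl, zero_le_one⟩
  refine ⟨H * (eVariationOn α (Set.Icc 0 1)).toReal + |h (α 0)|, ?_⟩
  rintro _ ⟨x, hx, rfl⟩
  calc |h (α x)| ≤ |h (α x) - h (α 0)| + |h (α 0)| := by
        simpa using abs_add_le (h (α x) - h (α 0)) (h (α 0))
    _ ≤ H * dist (α x) (α 0) + |h (α 0)| := by
        gcongr
        exact hh.dist_le_mul _ (Set.mem_image_of_mem α hx) _ (Set.mem_image_of_mem α h0)
    _ ≤ H * (eVariationOn α (Set.Icc 0 1)).toReal + |h (α 0)| := by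
        gcongr
        exact hα.dist_le hx h0

end Consistency

section Dyadic

variable {α h : ℝ → ℝ} {ε : ℝ}

lemma SignalAssumption.signalRange_subset_signalHull (hα : SignalAssumption α) :
    signalRange α ⊆ signalHull α := fun _ hx =>
  ⟨csInf_le hα.bddBelow hx, le_csSup hα.bddAbove hx⟩

lemma bandwidth_exponent_bounds {ϑ ζ : ℝ} (hA : (ε, ϑ, ζ) ∈ admissible) :
    0 < ζ ∧ 4 * ζ < ϑ ∧ 2 * ζ < 1 - ϑ ∧ 4 * ζ < ε := by
  obtain ⟨hζ, hζ_lt⟩ := hA.out.2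
  simp only [lt_min_iff] at hζ hζ_lt
  refine ⟨hζ, ?_, ?_, ?_⟩ <;> linarith

lemma scale_le_of_mem_indexSet {J : ℕ} {p : ℕ × ℕ} (hp : p ∈ indexSet ε J) :
    (2 : ℝ) ^ p.1 / 2 ^ J ≤ ((2 : ℝ) ^ J) ^ (-ε) := by
  have hle := hp.out.2.2
  rw [← Real.rpow_natCast 2 p.1, ← Real.rpow_natCast 2 J, ← Real.rpow_sub two_pos,
    ← Real.rpow_mul two_pos.le]
  exact Real.rpow_le_rpow_of_exponent_le one_le_two (by linarith)

lemma WeightAssumption.exists_isAveragingWeight {κ : ℕ → ℕ → ℕ → ℕ → ℝ}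
    (hκ : WeightAssumption ε κ) :
    ∃ C, ∀ J, ∀ p ∈ indexSet ε J,
      IsAveragingWeight (2 ^ J) (C * ((2 : ℝ) ^ J) ^ (-ε)) (κ J p.1 p.2) := by
  obtain ⟨C, hC⟩ := hκ.sum_sq
  refine ⟨max C 0, fun J p hp => ⟨hκ.nonneg J p hp, hκ.sum_one J p hp, (hC J p hp).trans ?_⟩⟩
  gcongr
  exacts [le_max_left C 0, scale_le_of_mem_indexSet hp]

lemma IsRegressionModel.exists_isSample {Ω : ℕ → Type*} [∀ J, MeasurableSpace (Ω J)]
    {P : ∀ J, Measure (Ω J)} [∀ J, IsFiniteMeasure (P J)] {X : ∀ J, ℕ → Ω J → ℝ}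
    (hX : IsRegressionModel P X α h) (hα : SignalAssumption α)
    (hh : VarianceFunctionAssumption α h) (hmoment : MomentAssumption P X α h) :
    ∃ m, ∀ J, IsSample (P J) (2 ^ J) (X J) (gridValues α (2 ^ J))
      (fun t => h (gridValues α (2 ^ J) t)) m := by
  obtain ⟨K₀, γ, hK₀, -, hmoment⟩ := hmoment
  obtain ⟨hm, hhm⟩ := hh.bddAbove
  refine ⟨(Nat.factorial 4 : ℝ) ^ (1 + γ) * K₀ ^ (4 - 2) * hm, fun J =>
    ⟨hX.measurable J, hX.indep J, fun t ht => ?_, hX.mean J, hX.variance J, fun t ht => ?_⟩⟩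
  · have hnoise : MemLp (noise α X J t) 4 (P J) :=
      (integrable_norm_rpow_iff ((hX.measurable J t ht).sub_const _).aestronglyMeasurable
        four_ne_zero ENNReal.ofNat_ne_top).1 <| by
          simpa [noise] using (hmoment J t ht 4 (by norm_num)).1
    exact (hnoise.add (memLp_const (gridValues α (2 ^ J) t))).ae_eq
      (ae_of_all _ fun ω => by simp [noise])
  · have hgrid := hα.signalRange_subset_signalHull
      (gridValues_mem_signalRange α (Finset.mem_Icc.1 ht))
    have hfour := (hmoment J t ht 4 (by norm_num)).2
    simp only [noise, Even.pow_abs (by decide : Even 4)] at hfour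
    refine hfour.trans ?_
    gcongr
    exact hhm (Set.mem_image_of_mem h hgrid)

end Dyadic

end WaveletFisz

open WaveletFisz in
theorem corollary1_general {ι : Type*} {l : Filter ι} {n : ι → ℕ} (hn : Tendsto n l atTop)
    {Ω : ι → Type*} [∀ i, MeasurableSpace (Ω i)]
    {P : ∀ i, Measure (Ω i)} [∀ i, IsProbabilityMeasure (P i)] {X : ∀ i, ℕ → Ω i → ℝ}
    {α h K : ℝ → ℝ} {M : ι → ℕ} {b δ : ι → ℝ} {pad : ι → ℤ → ℕ} {β : Type*} {S : ι → Set β}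
    {w : ι → β → ℕ → ℝ} {H Lk : ℝ≥0} {m a d c c₁ C ε ϑ ζ v : ℝ}
    (hX : ∀ i, IsSample (P i) (n i) (X i) (gridValues α (n i))
      (fun t => h (gridValues α (n i) t)) m)
    (htail : (fun i => 1 - (P i).real {ω | ∀ t ∈ Finset.Icc 1 (n i),
      |X i t ω - gridValues α (n i) t| ≤ a * Real.log (n i) ^ d}) =O[l]
        fun i => ((n i : ℝ) ^ 2)⁻¹)
    (ha : 0 < a) (hα : BoundedVariationOn α (Set.Icc 0 1))
    (hh : LipschitzOnWith H h (signalRange α))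
    (hK_nonneg : ∀ z, 0 ≤ K z)
    (hK_supp : ∀ z, z ∉ Set.Icc (-(1 / 2) : ℝ) (1 / 2) → K z = 0) (hK_lip : LipschitzWith Lk K)
    (hpad : ∀ i, IsBoundaryRule (n i) (pad i))
    (hw : ∀ i, ∀ p ∈ S i, IsAveragingWeight (n i) (C * (n i : ℝ) ^ (-ε)) (w i p))
    (hu : ∀ i, ∀ p ∈ S i, localMean (n i) (w i p) (gridValues α (n i)) ∈ signalRange α)
    (hdesign : ∀ᶠ i in l, ∀ u ∈ signalRange α,
      c₁ ≤ ∑ t ∈ Finset.Icc 1 (n i), kernelWeight K (n i) (b i) (gridValues α (n i) t) u)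
    (hc₁ : 0 < c₁) (hM : (fun i => (M i : ℝ)) =Θ[l] fun i => (n i : ℝ) ^ ϑ)
    (hb_pos : ∀ i, 0 < b i) (hb : b =Θ[l] fun i => (n i : ℝ) ^ (-ζ)) (hζ : 0 < ζ)
    (hζϑ : 4 * ζ < ϑ) (hζϑ' : 2 * ζ < 1 - ϑ) (hζε : 4 * ζ < ε) (hc : 0 < c)
    (hδ : ∀ᶠ i in l, c * Real.log (n i) ^ v ≤ δ i) :
    ∃ C', 0 ≤ C' ∧ ∀ᶠ i in l, ∀ p ∈ S i,
      (P i).real {ω | δ i ≤ |hHat K (n i) (M i) (b i) (pad i) (fun t => X i t ω)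
          (localMean (n i) (w i p) fun t => X i t ω) -
        h (localMean (n i) (w i p) (gridValues α (n i)))|} ≤ C' * ((n i : ℝ) ^ 2)⁻¹ := by
  have hn' : Tendsto (fun i => (n i : ℝ)) l atTop := tendsto_natCast_atTop_atTop.comp hn
  obtain ⟨hm, hh_le⟩ := exists_abs_le_of_lipschitzOnWith_signalRange hα hh
  obtain ⟨C', hC', htail_le⟩ := htail.exists_nonneg
  have hq : HasOrderLE l (fun i => (n i : ℝ)) _ (-2) := HasOrderLE.of_isBigO hn' <| by
    simpa only [Real.rpow_neg (Nat.cast_nonneg _), Real.rpow_ofNat] using htail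
  refine ⟨C' + 6, by positivity, ?_⟩
  filter_upwards [hδ, hdesign, htail_le.bound, hn.eventually_ge_atTop 2,
    eventually_errorBounds_lt hn' Lk H (eVariationOn α (Set.Icc 0 1)).toNNReal hm m C v
      ((HasOrderLE.log_rpow hn' d).const_mul a) hq hM hb hζ hζϑ hζϑ' hζε hc hc₁]
    with i hδi hdesign_i htail_i hni ⟨hshift, herror⟩ p hp
  have hlog : 0 < Real.log (n i) := Real.log_pos (by exact_mod_cast hni)
  have hvar : eVariationOn (gridValues α (n i)) (Set.Icc 1 (n i)) ≤
      (eVariationOn α (Set.Icc 0 1)).toNNReal :=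
    (eVariationOn_gridValues_le α (n i)).trans_eq (ENNReal.coe_toNNReal hα).symm
  refine ((hX i).measureReal_le_abs_hHat_sub_le (by omega) (hb_pos i) (by positivity) (hpad i)
    hK_nonneg hK_supp hK_lip hvar hh hh_le
    (fun t ht => gridValues_mem_signalRange α (Finset.mem_Icc.1 ht)) (hw i p hp) (hu i p hp) hc₁
    (hdesign_i _ (hu i p hp)) (probReal_compl_eq_one_sub ((hX i).measurableSet_noise_le _)).le
    hshift (herror.trans_le hδi)).trans ?_
  rw [add_mul, ← div_eq_mul_inv 6]
  gcongr
  exact (le_abs_self _).trans (htail_i.trans_eq (by rw [Real.norm_of_nonneg (by positivity)]))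

theorem corollary1 {Ω : ℕ → Type*} [∀ J, MeasurableSpace (Ω J)]
    (P : ∀ J, Measure (Ω J)) [∀ J, IsProbabilityMeasure (P J)]
    (X : ∀ J, ℕ → Ω J → ℝ) (α h K : ℝ → ℝ)
    (M : ℕ → ℕ) (b δ : ℕ → ℝ) (pad : ℕ → ℤ → ℕ) (κ : ℕ → ℕ → ℕ → ℕ → ℝ)
    (ε ϑ ζ v : ℝ)
    (hmodel : WaveletFisz.IsRegressionModel P X α h)
    (hpad : ∀ J, WaveletFisz.IsBoundaryRule (2 ^ J) (pad J))
    (h1 : WaveletFisz.SignalAssumption α)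
    (h2 : WaveletFisz.VarianceFunctionAssumption α h)
    (h3 : WaveletFisz.MomentAssumption P X α h)
    (h5 : WaveletFisz.WeightAssumption ε κ)
    (h6 : WaveletFisz.KernelAssumption K)
    (h7 : WaveletFisz.SquaredNoiseAssumption P X α)
    (h8 : WaveletFisz.AbsoluteDeviationAssumption P X M pad)
    (h9 : WaveletFisz.TailAssumption P X α)
    (h10 : WaveletFisz.DesignAssumption α K b)
    (h11 : WaveletFisz.LocalMeanAssumption α ε κ)
    (hA : (ε, ϑ, ζ) ∈ WaveletFisz.admissible)
    (hM : (fun J => (M J : ℝ)) =Θ[atTop] fun J : ℕ => ((2 : ℝ) ^ J) ^ ϑ)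
    (hb_pos : ∀ J, 0 < b J)
    (hb : b =Θ[atTop] fun J : ℕ => ((2 : ℝ) ^ J) ^ (-ζ))
    (hv : v < 0)
    (hδ : ∃ c : ℝ, 0 < c ∧ ∀ᶠ J : ℕ in atTop, c * Real.log ((2 : ℝ) ^ J) ^ v ≤ δ J) :
    ∃ ς : ℝ, 0 < ς ∧ ∃ C : ℝ, ∀ᶠ J : ℕ in atTop, ∀ p ∈ WaveletFisz.indexSet ε J,
      (P J).real {ω | δ J ≤
          |WaveletFisz.hHat K (2 ^ J) (M J) (b J) (pad J) (fun t => X J t ω)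
              (WaveletFisz.localMean (2 ^ J) (κ J p.1 p.2) (fun q => X J q ω)) -
            h (WaveletFisz.localMean (2 ^ J) (κ J p.1 p.2)
              (WaveletFisz.gridValues α (2 ^ J)))|} ≤
        C * (((2 : ℝ) ^ J) ^ ϑ * Real.exp (-(((2 : ℝ) ^ J) ^ (2 * ς)) / 2) +
          (((2 : ℝ) ^ J) ^ 2)⁻¹) := by
  obtain ⟨m, hX⟩ := hmodel.exists_isSample h1 h2 h3
  obtain ⟨H, hH⟩ := h2.lipschitz
  obtain ⟨Lk, hLk⟩ := h6.lipschitz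
  obtain ⟨a, d, ha, -, htail⟩ := h9
  obtain ⟨C, hC⟩ := h5.exists_isAveragingWeight
  obtain ⟨c₁, hc₁, hdesign⟩ := h10
  obtain ⟨c, hc, hδ⟩ := hδ
  obtain ⟨hζ, hζϑ, hζϑ', hζε⟩ := WaveletFisz.bandwidth_exponent_bounds hA
  have hcast (J : ℕ) : ((2 ^ J : ℕ) : ℝ) = 2 ^ J := by push_cast; rfl
  obtain ⟨C', hC', hbound⟩ := corollary1_general (n := fun J => 2 ^ J)
    (tendsto_pow_atTop_atTop_of_one_lt one_lt_two) (S := WaveletFisz.indexSet ε)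
    (w := fun J p => κ J p.1 p.2) hX
    (by simpa only [hcast, WaveletFisz.noise] using htail) ha h1.boundedVariation
    (hH.mono h1.signalRange_subset_signalHull) h6.nonneg h6.support hLk hpad
    (by simpa only [hcast] using hC) h11 hdesign hc₁ (by simpa only [hcast] using hM) hb_pos
    (by simpa only [hcast] using hb) hζ hζϑ hζϑ' hζε hc
    (by simpa only [hcast] using hδ)
  simp only [hcast] at hbound
  refine ⟨1, one_pos, C', hbound.mono fun J hJ p hp => (hJ p hp).trans ?_⟩
  gcongr
  exact le_add_of_nonneg_left (by positivity)
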